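/- All graphs are finite, simple and non-empty. A graph is 2-connected if it is connected and has no cut-vertex (so a single vertex and a single edge are 2-connected). A graph $H$ is a minor of $G$ if there are pairwise disjoint, non-empty, connected vertex sets $B_a\subseteq V(G)$, $a\in V(H)$, with an edge of $G$ between $B_a$ and $B_b$ whenever $ab\in E(H)$; $G$ is $H$-minor-free if $H$ is not a minor of $G$. Fix an integer $k\ge 1$. In a connected graph $G$ on $n$ vertices every vertex $v$ has an identifier in $\{1,\dots,n^k\}$, and distinct vertices have distinct identifiers. Each vertex is moreover assigned a certificate, which is a finite string of bits. A verifier is a function that decides, for each vertex, to accept or reject, given only the identifier and certificate of that vertex and the set of pairs (identifier, certificate) of its neighbours. For $f:\mathbb N\to\mathbb N$, a class $\mathcal C$ of connected graphs can be certified with $f(n)$ bits if there is a verifier such that for every $n$, every connected graph $G$ on $n$ vertices and every assignment of identifiers to $G$ as above: (1) if $G\in\mathcal C$, then there is an assignment of certificates of at most $f(n)$ bits for which all vertices accept; (2) if $G\notin\mathcal C$, then for every assignment of certificates, of any length, at least one vertex rejects. Theorem. Let $k\ge 1$ and let $H$ be a 2-connected graph. There is a constant $C$, depending only on $k$ and $H$,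 such that for every non-decreasing $f:\mathbb N\to\mathbb N$: if the class of 2-connected $H$-minor-free graphs can be certified with $f(n)$ bits, then the class of connected $H$-minor-free graphs can be certified with $C\cdot(f(n)+\lfloor\log_2 n\rfloor)$ bits, that is, with $O(f(n)+\log n)$ bits. -/

import Mathlib

namespace LocalCert

/-- `H` is a minor of `G`, through a model of `H` in `G`: pairwise disjoint (nonempty) connected
branch sets, one for each vertex of `H`, with an edge of `G` between the branch sets of any two
adjacent vertices of `H`. -/
def IsMinor {W : Type*} {V : Type*} (H : SimpleGraph W) (G : SimpleGraph V) : Prop :=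
  ∃ B : W → Set V,
    (∀ a, (G.induce (B a)).Connected) ∧
    (∀ a b, a ≠ b → Disjoint (B a) (B b)) ∧
    (∀ a b, H.Adj a b → ∃ x ∈ B a, ∃ y ∈ B b, G.Adj x y)

/-- `G` is `H`-minor-free. -/
def MinorFree {W : Type*} {V : Type*} (H : SimpleGraph W) (G : SimpleGraph V) : Prop :=
  ¬ IsMinor H G

/-- A graph is 2-connected if it is connected and has no cut-vertex. The one-vertex graph and the
single edge count as 2-connected (a block of a graph may be a bridge). -/
def TwoConnected {V : Type*} (G : SimpleGraph V) : Prop :=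
  G.Connected ∧ ∀ v : V, (G.induce {v}ᶜ).Preconnected

/-- A certificate is a string of bits. -/
abbrev Certificate : Type := List Bool

/-- A verifier at distance 1: it reads the identifier and the certificate of a node, and the
identifiers and certificates of its neighbors, and outputs `true` (accept) or `false` (reject). -/
abbrev Verifier : Type := ℕ × Certificate → Finset (ℕ × Certificate) → Bool

/-- Unique identifiers in the range `[1, n ^ k]`, where `n` is the number of nodes. -/
def ValidIds {V : Type} [Fintype V] (k : ℕ) (ids : V → ℕ) : Prop :=
  Function.Injective ids ∧ ∀ v, 1 ≤ ids v ∧ ids v ≤ Fintype.card V ^ k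

open Classical in
/-- What a node `v` collects from its neighbors: their identifiers and certificates. -/
noncomputable def neighborView {V : Type} [Fintype V] (G : SimpleGraph V) (ids : V → ℕ)
    (c : V → Certificate) (v : V) : Finset (ℕ × Certificate) :=
  (Finset.univ.filter (fun u => G.Adj v u)).image (fun u => (ids u, c u))

/-- The verifier accepts the certificate assignment `c`: every node outputs accept. -/
def Accepts (A : Verifier) {V : Type} [Fintype V] (G : SimpleGraph V) (ids : V → ℕ)
    (c : V → Certificate) : Prop :=
  ∀ v, A (ids v, c v) (neighborView G ids c v) = true

/-- The class `P` of (connected, finite) graphs can be certified with `f n`-bit certificates when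
identifiers are taken in `[1, n ^ k]`: there is one verifier such that, for every connected graph
`G` on `n` nodes and all identifiers in that range,
* if `G` is in `P`, some assignment of certificates of at most `f n` bits is accepted;
* if `G` is not in `P`, no assignment of certificates, of any size, is accepted. -/
def CertifiableWith (k : ℕ) (f : ℕ → ℕ) (P : ∀ {V : Type}, SimpleGraph V → Prop) : Prop :=
  ∃ A : Verifier, ∀ (V : Type) [Fintype V] (G : SimpleGraph V), G.Connected →
    ∀ ids : V → ℕ, ValidIds k ids →
      (P G → ∃ c : V → Certificate,
        (∀ v, (c v).length ≤ f (Fintype.card V)) ∧ Accepts A G ids c) ∧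
      (¬ P G → ∀ c : V → Certificate, ¬ Accepts A G ids c)

end LocalCert

/-! Splitting a connected graph repeatedly at cut-vertices yields 2-connected pieces, glued along
single vertices in a tree-like way (`exists_blockDecomp`). Since `H` is 2-connected, a model of `H`
can be pushed to one side of a cut-vertex (`MinorIn.of_separation`), so a graph is `H`-minor-free as
soon as its pieces are (`minorFree_of_parts`). It remains to certify the gluing and, with the given
verifier, every piece.

Apart from one global root, each vertex is a non-root vertex of exactly one piece and stores its
certificate for that piece only. A vertex may be the root of many pieces; its certificate for such a
piece is instead copied into the records of the other vertices of the piece. Depths that drop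
strictly from a part to its root force the gluing to be tree-like.

The given verifier expects identifiers that are polynomial in the size of the piece, while the
actual ones are only polynomial in `n`. Each piece is therefore renumbered: the root gets 1, the
others their numbers in an interval numbering of a spanning tree. This numbering can be checked
locally, and the checks alone force the numbers to be distinct and without gaps (`Numbering.injOn`,
`Numbering.hi_root_le`).

Soundness is `minorFree_of_localCheck`; it does not need the claimed pieces to be 2-connected,
because acceptance by the given verifier already excludes an `H`-minor. Completeness is
`exists_localCheck`. -/

namespace LocalCert

open SimpleGraph

/-! ### Minors of 2-connected graphs and separations of order one. -/

section Graph

variable {V W : Type*}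

/-- More flexible than a homomorphism: `f` may collapse edges. -/
theorem reachable_of_adj_reachable {V' : Type*} {G : SimpleGraph V} {G' : SimpleGraph V'}
    (f : V → V') (h : ∀ u v, G.Adj u v → G'.Reachable (f u) (f v)) {u v : V}
    (huv : G.Reachable u v) : G'.Reachable (f u) (f v) := by
  obtain ⟨p⟩ := huv
  induction p with
  | nil => exact Reachable.refl _
  | cons hadj _ ih => exact (h _ _ hadj).trans ih

theorem reachable_induction {G : SimpleGraph V} {p : V → Prop}
    (h : ∀ u v, G.Adj u v → p u → p v) {u v : V} (huv : G.Reachable u v) (hu : p u) : p v := by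
  obtain ⟨w⟩ := huv
  induction w with
  | nil => exact hu
  | cons hadj _ ih => exact ih (h _ _ hadj hu)

/-- A connected set meeting the separator of a separation of order one stays connected when it is
restricted to one side. -/
theorem connected_induce_inter {G : SimpleGraph V} {C X Y : Set V} {r : V}
    (hC : (G.induce C).Connected) (hr : r ∈ C) (hrX : r ∈ X) (hXY : ∀ u ∈ X, u ∈ Y → u = r)
    (he : ∀ x ∈ C, ∀ y ∈ C, G.Adj x y → (x ∈ X ∧ y ∈ X) ∨ (x ∈ Y ∧ y ∈ Y)) :
    (G.induce (C ∩ X)).Connected := by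
  classical
  let R : ↥(C ∩ X) := ⟨r, hr, hrX⟩
  -- `f` collapses everything outside `X` onto `r`; an edge inside `X` is kept and an edge inside
  -- `Y` becomes a point.
  let f : C → ↥(C ∩ X) := fun u => if h : u.1 ∈ X then ⟨u.1, u.2, h⟩ else R
  have hf : ∀ (u : C), u.1 ∈ Y → f u = R := by
    intro u hu
    by_cases h : u.1 ∈ X
    · simp only [f, h, dif_pos]
      exact Subtype.ext (hXY _ h hu)
    · simp only [f, h, dif_neg, not_false_eq_true]
  have key : ∀ u v : C, (G.induce C).Adj u v → (G.induce (C ∩ X)).Reachable (f u) (f v) := by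
    intro u v huv
    rcases he u.1 u.2 v.1 v.2 huv with ⟨h1, h2⟩ | ⟨h1, h2⟩
    · have : (G.induce (C ∩ X)).Adj (f u) (f v) := by
        simp only [f, h1, h2, dif_pos]
        exact huv
      exact this.reachable
    · rw [hf u h1, hf v h2]
  have : Nonempty ↥(C ∩ X) := ⟨R⟩
  refine ⟨fun u v => ?_⟩
  have h := reachable_of_adj_reachable f key (hC.preconnected ⟨u.1, u.2.1⟩ ⟨v.1, v.2.1⟩)
  simpa only [f, u.2.2, v.2.2, dif_pos] using h

/-- A connected set avoiding the separator lies on one side. -/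
theorem subset_or_subset_of_connected {G : SimpleGraph V} {C X Y : Set V} {r : V}
    (hC : (G.induce C).Connected) (hr : r ∉ C) (hXY : ∀ u ∈ X, u ∈ Y → u = r)
    (hCXY : C ⊆ X ∪ Y)
    (he : ∀ x ∈ C, ∀ y ∈ C, G.Adj x y → (x ∈ X ∧ y ∈ X) ∨ (x ∈ Y ∧ y ∈ Y)) :
    C ⊆ X ∨ C ⊆ Y := by
  by_cases h : ∃ x ∈ C, x ∈ X
  · left
    obtain ⟨x, hxC, hxX⟩ := h
    intro y hy
    refine reachable_induction (G := G.induce C) (p := fun u => u.1 ∈ X) ?_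
      (hC.preconnected ⟨x, hxC⟩ ⟨y, hy⟩) hxX
    intro u v huv hu
    rcases he u.1 u.2 v.1 v.2 huv with ⟨_, h2⟩ | ⟨h1, _⟩
    · exact h2
    · exact absurd (hXY _ hu h1 ▸ u.2) hr
  · right
    intro y hy
    rcases hCXY hy with h' | h'
    · exact absurd ⟨y, hy, h'⟩ h
    · exact h'

/-- A model of `H` in `G` with all branch sets inside `S`. -/
def MinorIn (H : SimpleGraph W) (G : SimpleGraph V) (S : Set V) : Prop :=
  ∃ B : W → Set V, (∀ a, B a ⊆ S) ∧
    (∀ a, (G.induce (B a)).Connected) ∧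
    (∀ a b, a ≠ b → Disjoint (B a) (B b)) ∧
    (∀ a b, H.Adj a b → ∃ x ∈ B a, ∃ y ∈ B b, G.Adj x y)

theorem MinorIn.mono {H : SimpleGraph W} {G : SimpleGraph V} {S T : Set V}
    (h : MinorIn H G S) (hST : S ⊆ T) : MinorIn H G T := by
  obtain ⟨B, h0, h1⟩ := h
  exact ⟨B, fun a => (h0 a).trans hST, h1⟩

theorem IsMinor.minorIn_univ {H : SimpleGraph W} {G : SimpleGraph V} (h : IsMinor H G) :
    MinorIn H G Set.univ := by
  obtain ⟨B, h1⟩ := h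
  exact ⟨B, fun a => Set.subset_univ _, h1⟩

theorem connected_induce_image {G : SimpleGraph V} {S : Set V} {B : Set S}
    (h : ((G.induce S).induce B).Connected) : (G.induce (Subtype.val '' B)).Connected := by
  obtain ⟨b⟩ := id h.nonempty
  have : Nonempty ↥(Subtype.val '' B : Set V) := ⟨⟨b.1.1, b.1, b.2, rfl⟩⟩
  refine ⟨?_⟩
  rintro ⟨_, u, hu, rfl⟩ ⟨_, v, hv, rfl⟩
  exact reachable_of_adj_reachable
    (G' := G.induce (Subtype.val '' B : Set V))
    (fun x : B => (⟨x.1.1, x.1, x.2, rfl⟩ : ↥(Subtype.val '' B : Set V)))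
    (fun x y hxy => Adj.reachable (by exact hxy)) (h.preconnected ⟨u, hu⟩ ⟨v, hv⟩)

theorem connected_induce_preimage {G : SimpleGraph V} {S B : Set V} (hBS : B ⊆ S)
    (h : (G.induce B).Connected) :
    ((G.induce S).induce (Subtype.val ⁻¹' B : Set S)).Connected := by
  obtain ⟨b⟩ := id h.nonempty
  have : Nonempty ↥(Subtype.val ⁻¹' B : Set S) := ⟨⟨⟨b.1, hBS b.2⟩, b.2⟩⟩
  refine ⟨fun u v => ?_⟩
  exact reachable_of_adj_reachable
    (G' := (G.induce S).induce (Subtype.val ⁻¹' B : Set S))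
    (fun x : B => (⟨⟨x.1, hBS x.2⟩, x.2⟩ : ↥(Subtype.val ⁻¹' B : Set S)))
    (fun x y hxy => Adj.reachable (by exact hxy)) (h.preconnected ⟨u.1.1, u.2⟩ ⟨v.1.1, v.2⟩)

theorem isMinor_induce_iff {H : SimpleGraph W} {G : SimpleGraph V} {S : Set V} :
    IsMinor H (G.induce S) ↔ MinorIn H G S := by
  constructor
  · rintro ⟨B, h1, h2, h3⟩
    refine ⟨fun a => Subtype.val '' B a, ?_, fun a => connected_induce_image (h1 a), ?_, ?_⟩
    · rintro a _ ⟨x, _, rfl⟩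
      exact x.2
    · intro a b hab
      exact (Set.disjoint_image_iff Subtype.val_injective).2 (h2 a b hab)
    · intro a b hab
      obtain ⟨x, hx, y, hy, hxy⟩ := h3 a b hab
      exact ⟨x.1, ⟨x, hx, rfl⟩, y.1, ⟨y, hy, rfl⟩, hxy⟩
  · rintro ⟨B, h0, h1, h2, h3⟩
    refine ⟨fun a => Subtype.val ⁻¹' B a, fun a => connected_induce_preimage (h0 a) (h1 a),
      fun a b hab => (h2 a b hab).preimage _, ?_⟩
    intro a b hab
    obtain ⟨x, hx, y, hy, hxy⟩ := h3 a b hab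
    exact ⟨⟨x, h0 a hx⟩, hx, ⟨y, h0 b hy⟩, hy, hxy⟩

theorem MinorIn.isMinor {H : SimpleGraph W} {G : SimpleGraph V} {S : Set V}
    (h : MinorIn H G S) : IsMinor H G := by
  obtain ⟨B, _, h1⟩ := h
  exact ⟨B, h1⟩

/-- A model of a 2-connected graph can be moved to one side of a separation of order one. -/
theorem MinorIn.of_separation {H : SimpleGraph W} {G : SimpleGraph V} (hH : TwoConnected H)
    {S X Y : Set V} {r : V} (hrX : r ∈ X) (hrY : r ∈ Y) (hXY : ∀ u ∈ X, u ∈ Y → u = r)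
    (hS : S ⊆ X ∪ Y)
    (he : ∀ x ∈ S, ∀ y ∈ S, G.Adj x y → (x ∈ X ∧ y ∈ X) ∨ (x ∈ Y ∧ y ∈ Y))
    (h : MinorIn H G S) : MinorIn H G (S ∩ X) ∨ MinorIn H G (S ∩ Y) := by
  obtain ⟨B, h0, h1, h2, h3⟩ := h
  have side : ∀ X Y : Set V, r ∈ X → (∀ u ∈ X, u ∈ Y → u = r) →
      (∀ x ∈ S, ∀ y ∈ S, G.Adj x y → (x ∈ X ∧ y ∈ X) ∨ (x ∈ Y ∧ y ∈ Y)) →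
      (∀ a, r ∉ B a → B a ⊆ X) → MinorIn H G (S ∩ X) := by
    intro X Y hrX hXY he hB
    refine ⟨fun a => B a ∩ X, fun a => Set.inter_subset_inter_left _ (h0 a), ?_, ?_, ?_⟩
    · intro a
      by_cases hr : r ∈ B a
      · exact connected_induce_inter (h1 a) hr hrX hXY
          fun x hx y hy => he x (h0 a hx) y (h0 a hy)
      · have : B a ∩ X = B a := Set.inter_eq_left.2 (hB a hr)
        change (G.induce (B a ∩ X)).Connected
        rw [this]
        exact h1 a
    · intro a b hab
      exact (h2 a b hab).mono Set.inter_subset_left Set.inter_subset_left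
    · intro a b hab
      obtain ⟨x, hx, y, hy, hxy⟩ := h3 a b hab
      rcases he x (h0 a hx) y (h0 b hy) hxy with ⟨hx', hy'⟩ | ⟨hx', hy'⟩
      · exact ⟨x, ⟨hx, hx'⟩, y, ⟨hy, hy'⟩, hxy⟩
      -- Such an edge cannot occur: the end whose branch set avoids `r` would lie on both sides and
      -- so equal `r`.
      · by_cases hr : r ∈ B a
        · have hr' : r ∉ B b := fun h => Set.disjoint_left.1 (h2 a b hab.ne) hr h
          have := hXY y (hB b hr' hy) hy'
          exact absurd (this ▸ hy) hr'
        · have := hXY x (hB a hr hx) hx'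
          exact absurd (this ▸ hx) hr
  have lies : ∀ a, r ∉ B a → B a ⊆ X ∨ B a ⊆ Y := fun a hr =>
    subset_or_subset_of_connected (h1 a) hr hXY ((h0 a).trans hS)
      fun x hx y hy => he x (h0 a hx) y (h0 a hy)
  have step : ∀ a b, r ∉ B a → r ∉ B b → H.Adj a b → B a ⊆ X → B b ⊆ X := by
    intro a b hra hrb hab hBa
    refine (lies b hrb).resolve_right fun hBb => ?_
    obtain ⟨x, hx, y, hy, hxy⟩ := h3 a b hab
    rcases he x (h0 a hx) y (h0 b hy) hxy with ⟨_, hy'⟩ | ⟨hx', _⟩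
    · exact hrb (hXY y hy' (hBb hy) ▸ hy)
    · exact hra (hXY x (hBa hx) hx' ▸ hx)
  -- The branch sets avoiding `r` are indexed by `H`, or by `H` minus one vertex; both are
  -- connected, and `step` carries the side along edges.
  have all : ∀ a b, r ∉ B a → r ∉ B b → B a ⊆ X → B b ⊆ X := by
    intro a b hra hrb hBa
    by_cases hex : ∃ c, r ∈ B c
    · obtain ⟨c, hc⟩ := hex
      have hout : ∀ d, d ≠ c → r ∉ B d := fun d hd h =>
        Set.disjoint_left.1 (h2 d c hd) h hc
      have hac : a ≠ c := fun h => hra (h ▸ hc)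
      have hbc : b ≠ c := fun h => hrb (h ▸ hc)
      exact reachable_induction (G := H.induce {c}ᶜ) (p := fun d => B d.1 ⊆ X)
        (fun u v huv hu => step u.1 v.1 (hout _ u.2) (hout _ v.2) huv hu)
        (hH.2 c ⟨a, hac⟩ ⟨b, hbc⟩) hBa
    · push Not at hex
      exact reachable_induction (p := fun d => B d ⊆ X)
        (fun u v huv hu => step u v (hex u) (hex v) huv hu) (hH.1.preconnected a b) hBa
  by_cases hX : ∃ a, r ∉ B a ∧ B a ⊆ X
  · obtain ⟨a, hra, hBa⟩ := hX
    exact Or.inl (side X Y hrX hXY he fun b hb => all a b hra hb hBa)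
  · push Not at hX
    exact Or.inr (side Y X hrY (fun u hu hu' => hXY u hu' hu)
      (fun x hx y hy hxy => (he x hx y hy hxy).symm)
      fun b hb => (lies b hb).resolve_left (hX b hb))

/-- A graph glued in a tree-like way, along single vertices, from graphs without an `H`-minor has
no `H`-minor, if `H` is 2-connected. The vertices of nonzero depth are partitioned by `lead`, and
`root u` is the vertex along which the part of `u` is attached. -/
theorem minorFree_of_parts [Finite V] [Nontrivial W] {H : SimpleGraph W} {G : SimpleGraph V}
    (hH : TwoConnected H) {L : Type*} (depth : V → ℕ) (lead : V → L) (root : V → V)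
    (hroot : ∀ u, depth u ≠ 0 → depth (root u) < depth u)
    (hconst : ∀ u w, depth u ≠ 0 → depth w ≠ 0 → lead u = lead w →
      root u = root w ∧ depth u = depth w)
    (hedge : ∀ u w, G.Adj u w → (depth w ≠ 0 ∧ root w = u) ∨ (depth u ≠ 0 ∧ root u = w) ∨
      (depth u ≠ 0 ∧ depth w ≠ 0 ∧ lead u = lead w))
    (hblock : ∀ u, depth u ≠ 0 →
      ¬ MinorIn H G (insert (root u) {w | depth w ≠ 0 ∧ lead w = lead u})) :
    MinorFree H G := by
  -- Parts are peeled off one by one, so the claim is proved for every `S` that contains each part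
  -- it meets.
  have main : ∀ n : ℕ, ∀ S : Set V, S.ncard = n →
      (∀ u ∈ S, depth u ≠ 0 → ∀ w, depth w ≠ 0 → lead w = lead u → w ∈ S) →
      ¬ MinorIn H G S := by
    intro n
    induction n using Nat.strong_induction_on with
    | _ n ih =>
    intro S hn hS hmin
    by_cases hex : ∃ u ∈ S, depth u ≠ 0
    · obtain ⟨u₀, hu₀, hd₀⟩ := hex
      -- No part inside `S` hangs from a deepest one, so within `S` its edges leave only to `root
      -- u`.
      obtain ⟨u, ⟨huS, hud⟩, humax⟩ := Set.exists_max_image {u | u ∈ S ∧ depth u ≠ 0} depth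
        (Set.toFinite _) ⟨u₀, hu₀, hd₀⟩
      set P : Set V := {w | depth w ≠ 0 ∧ lead w = lead u} with hP
      have hPd : ∀ w ∈ P, root w = root u ∧ depth w = depth u := fun w hw =>
        hconst w u hw.1 hud hw.2
      have hrP : root u ∉ P := fun h => by
        have h1 := hroot u hud
        have h2 := (hPd _ h).2
        omega
      have hnot : ∀ x ∈ P, ∀ y ∈ S, ¬ (depth y ≠ 0 ∧ root y = x) := by
        rintro x hx y hy ⟨hyd, hyx⟩
        have h1 := hroot y hyd
        have h2 := humax y ⟨hy, hyd⟩
        rw [hyx, (hPd x hx).2] at h1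
        omega
      have hout : ∀ x ∈ P, ∀ y ∈ S, G.Adj x y → y ∈ insert (root u) P := by
        intro x hx y hy hxy
        rcases hedge x y hxy with h | h | h
        · exact absurd h (hnot x hx y hy)
        · left
          rw [← h.2, (hPd x hx).1]
        · exact Or.inr ⟨h.2.1, h.2.2.symm.trans hx.2⟩
      rcases hmin.of_separation hH (X := insert (root u) P) (Y := Pᶜ) (r := root u)
        (Set.mem_insert _ _) hrP (fun v hv hv' => hv.resolve_right hv')
        (fun v _ => by
          by_cases hv : v ∈ P
          · exact Or.inl (Or.inr hv)
          · exact Or.inr hv)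
        (fun x hx y hy hxy => by
          by_cases hxP : x ∈ P
          · exact Or.inl ⟨Or.inr hxP, hout x hxP y hy hxy⟩
          · by_cases hyP : y ∈ P
            · exact Or.inl ⟨hout y hyP x hx hxy.symm, Or.inr hyP⟩
            · exact Or.inr ⟨hxP, hyP⟩) with h | h
      · exact hblock u hud (h.mono Set.inter_subset_right)
      · refine ih (S ∩ Pᶜ).ncard ?_ _ rfl ?_ h
        · rw [← hn]
          refine Set.ncard_lt_ncard ⟨Set.inter_subset_left, fun hsub => ?_⟩ (Set.toFinite _)
          exact (hsub huS).2 ⟨hud, rfl⟩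
        · intro v hv hvd w hwd hwv
          exact ⟨hS v hv.1 hvd w hwd hwv, fun hw => hv.2 ⟨hvd, hwv.symm.trans hw.2⟩⟩
    -- Vertices of depth zero span no edge, whereas `H` has one.
    · push Not at hex
      obtain ⟨B, h0, _, _, h3⟩ := hmin
      obtain ⟨a⟩ := hH.1.nonempty
      obtain ⟨b, hab⟩ := hH.1.preconnected.exists_adj_of_nontrivial a
      obtain ⟨x, hx, y, hy, hxy⟩ := h3 a b hab
      have hx0 := hex x (h0 a hx)
      have hy0 := hex y (h0 b hy)
      rcases hedge x y hxy with h | h | h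
      · exact h.1 hy0
      · exact h.1 hx0
      · exact h.1 hx0
  intro hmin
  exact main _ Set.univ rfl (fun _ _ _ _ _ _ => Set.mem_univ _) hmin.minorIn_univ

end Graph

/-! ### Decomposition into 2-connected pieces. -/

section Decomposition

variable {V : Type*}

/-- A connected set which is not 2-connected splits at a vertex `v`, with a given vertex `r` not
in the part `K` that is cut off. -/
theorem exists_split {G : SimpleGraph V} {S : Set V} {r : V}
    (hS : (G.induce S).Connected) (hn : ¬ TwoConnected (G.induce S)) :
    ∃ v ∈ S, ∃ K ⊆ S, v ∉ K ∧ r ∉ K ∧ K.Nonempty ∧ (∃ z ∈ S, z ∉ K ∧ z ≠ v) ∧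
      ∀ x ∈ K, ∀ y ∈ S, G.Adj x y → y ∈ K ∨ y = v := by
  have : ∃ v : S, ∃ x y : ↥({v}ᶜ : Set S), ¬ ((G.induce S).induce {v}ᶜ).Reachable x y := by
    by_contra! hcon
    exact hn ⟨hS, fun v x y => hcon v x y⟩
  obtain ⟨v, x, y, hxy⟩ := this
  let K : ↥({v}ᶜ : Set S) → Set V := fun x =>
    {z | ∃ z' : ↥({v}ᶜ : Set S), ((G.induce S).induce {v}ᶜ).Reachable x z' ∧ z'.1.1 = z}
  have key : ∀ x y : ↥({v}ᶜ : Set S), ¬ ((G.induce S).induce {v}ᶜ).Reachable x y → r ∉ K x →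
      ∃ v ∈ S, ∃ K ⊆ S, v ∉ K ∧ r ∉ K ∧ K.Nonempty ∧ (∃ z ∈ S, z ∉ K ∧ z ≠ v) ∧
      ∀ x ∈ K, ∀ y ∈ S, G.Adj x y → y ∈ K ∨ y = v := by
    intro x y hxy hr
    refine ⟨v.1, v.2, K x, ?_, ?_, hr, ⟨x.1.1, x, Reachable.refl _, rfl⟩,
      ⟨y.1.1, y.1.2, ?_, ?_⟩, ?_⟩
    · rintro _ ⟨z', _, rfl⟩
      exact z'.1.2
    · rintro ⟨z', _, hz⟩
      exact z'.2 (Subtype.ext hz)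
    · rintro ⟨z', hz', hz⟩
      exact hxy ((Subtype.ext (Subtype.ext hz) : z' = y) ▸ hz')
    · intro h
      exact y.2 (Subtype.ext h)
    · rintro _ ⟨z', hz', rfl⟩ w hw hzw
      by_cases hwv : w = v.1
      · exact Or.inr hwv
      · refine Or.inl ⟨⟨⟨w, hw⟩, fun h => hwv (congrArg Subtype.val h)⟩, hz'.trans ?_, rfl⟩
        exact Adj.reachable (by exact hzw)
  -- `K x` and `K y` are different components of `S` minus `v`, so at least one of them avoids `r`.
  by_cases hr : r ∈ K x
  · refine key y x (fun h => hxy h.symm) ?_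
    rintro ⟨z', hz', hz⟩
    obtain ⟨z, hz1, hz2⟩ := hr
    have : z = z' := Subtype.ext (Subtype.ext (hz2.trans hz.symm))
    subst this
    exact hxy (hz1.trans hz'.symm)
  · exact key x y hxy hr

/-- A rooted decomposition of the set `S` into 2-connected pieces: the vertices of `S` other than
`r` are partitioned by `lead`, and the part of `u` together with `root u` is 2-connected. -/
structure BlockDecomp (G : SimpleGraph V) (S : Set V) (r : V) (lead root : V → V)
    (depth : V → ℕ) : Prop where
  depth_root : depth r = 0
  depth_ne_zero : ∀ u ∈ S, u ≠ r → depth u ≠ 0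
  depth_lt : ∀ u ∈ S, u ≠ r → depth (root u) < depth u
  depth_le : ∀ u ∈ S, depth u < S.ncard
  root_mem : ∀ u ∈ S, u ≠ r → root u ∈ S
  lead_mem : ∀ u ∈ S, u ≠ r → lead u ∈ S
  lead_ne : ∀ u ∈ S, u ≠ r → lead u ≠ r
  lead_lead : ∀ u ∈ S, u ≠ r → lead (lead u) = lead u
  -- This edge lets the leader confirm that the root exists, and lets the root see a record of the
  -- part.
  adj : ∀ u ∈ S, u ≠ r → G.Adj (root u) (lead u)
  const : ∀ u ∈ S, ∀ w ∈ S, u ≠ r → w ≠ r → lead u = lead w →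
    root u = root w ∧ depth u = depth w
  edge : ∀ u ∈ S, ∀ w ∈ S, G.Adj u w → (w ≠ r ∧ root w = u) ∨ (u ≠ r ∧ root u = w) ∨
    (u ≠ r ∧ w ≠ r ∧ lead u = lead w)
  block : ∀ u ∈ S, u ≠ r →
    TwoConnected (G.induce (insert (root u) {w | w ∈ S ∧ w ≠ r ∧ lead w = lead u}))

open Classical in
-- The two sides meet only in `v`. The side `insert v K` is rooted at `v`, so its depths are shifted
-- by that of `v`; leaders stay on their own side, so no parts merge.
theorem BlockDecomp.glue [Finite V] {G : SimpleGraph V} {S K : Set V} {r v : V}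
    {lead₁ root₁ lead₂ root₂ : V → V} {depth₁ depth₂ : V → ℕ}
    (hKS : K ⊆ S) (hv : v ∈ S) (hvK : v ∉ K) (hrK : r ∉ K)
    (hedge : ∀ x ∈ K, ∀ y ∈ S, G.Adj x y → y ∈ K ∨ y = v)
    (h₁ : BlockDecomp G (S \ K) r lead₁ root₁ depth₁)
    (h₂ : BlockDecomp G (insert v K) v lead₂ root₂ depth₂) :
    BlockDecomp G S r (fun u => if u ∈ K then lead₂ u else lead₁ u)
      (fun u => if u ∈ K then root₂ u else root₁ u)
      (fun u => if u ∈ K then depth₂ u + depth₁ v else depth₁ u) := by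
  have hvS : v ∈ S \ K := ⟨hv, hvK⟩
  have hK : ∀ u ∈ K, u ∈ insert v K ∧ u ≠ v := fun u hu =>
    ⟨Or.inr hu, fun h => hvK (h ▸ hu)⟩
  have hKr : ∀ u ∈ K, u ≠ r := fun u hu h => hrK (h ▸ hu)
  have lead₂_mem : ∀ u ∈ K, lead₂ u ∈ K := fun u hu =>
    (h₂.lead_mem u (hK u hu).1 (hK u hu).2).resolve_left (h₂.lead_ne u (hK u hu).1 (hK u hu).2)
  have root₂_mem : ∀ u ∈ K, root₂ u = v ∨ root₂ u ∈ K := fun u hu =>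
    h₂.root_mem u (hK u hu).1 (hK u hu).2
  have lead₁_mem : ∀ u ∈ S, u ∉ K → u ≠ r → lead₁ u ∈ S ∧ lead₁ u ∉ K := fun u hu hu' hur =>
    h₁.lead_mem u ⟨hu, hu'⟩ hur
  have root₁_mem : ∀ u ∈ S, u ∉ K → u ≠ r → root₁ u ∈ S ∧ root₁ u ∉ K := fun u hu hu' hur =>
    h₁.root_mem u ⟨hu, hu'⟩ hur
  -- The overlap in the single vertex `v` is what keeps the shifted depths below `S.ncard`.
  have hcard : (S \ K).ncard + (insert v K).ncard = S.ncard + 1 := by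
    rw [Set.ncard_insert_of_notMem hvK, ← Set.ncard_sdiff_add_ncard_of_subset hKS]
    omega
  have hlead_ne : ∀ u ∈ S, ∀ w ∈ S, u ∈ K → w ∉ K → w ≠ r → lead₂ u ≠ lead₁ w := by
    intro u _ w hw huK hwK hwr h
    exact (lead₁_mem w hw hwK hwr).2 (h ▸ lead₂_mem u huK)
  constructor
  · simp only [hrK, if_false]
    exact h₁.depth_root
  · intro u hu hur
    by_cases huK : u ∈ K
    · have := h₂.depth_ne_zero u (hK u huK).1 (hK u huK).2
      simp only [huK, if_true]
      omega
    · simp only [huK, if_false]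
      exact h₁.depth_ne_zero u ⟨hu, huK⟩ hur
  · intro u hu hur
    by_cases huK : u ∈ K
    · have := h₂.depth_lt u (hK u huK).1 (hK u huK).2
      simp only [huK, if_true]
      rcases root₂_mem u huK with h | h
      · rw [h] at this ⊢
        simp only [hvK, if_false]
        omega
      · simp only [h, if_true]
        omega
    · simp only [huK, if_false, (root₁_mem u hu huK hur).2]
      exact h₁.depth_lt u ⟨hu, huK⟩ hur
  · intro u hu
    have hv1 := h₁.depth_le v hvS
    by_cases huK : u ∈ K
    · have := h₂.depth_le u (hK u huK).1
      simp only [huK, if_true]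
      omega
    · have := h₁.depth_le u ⟨hu, huK⟩
      have hpos : 0 < (insert v K).ncard := (Set.ncard_pos (Set.toFinite _)).2 ⟨v, Or.inl rfl⟩
      simp only [huK, if_false]
      omega
  · intro u hu hur
    by_cases huK : u ∈ K
    · simp only [huK, if_true]
      rcases root₂_mem u huK with h | h
      · exact h ▸ hv
      · exact hKS h
    · simp only [huK, if_false]
      exact (root₁_mem u hu huK hur).1
  · intro u hu hur
    by_cases huK : u ∈ K
    · simp only [huK, if_true]
      exact hKS (lead₂_mem u huK)
    · simp only [huK, if_false]
      exact (lead₁_mem u hu huK hur).1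
  · intro u hu hur
    by_cases huK : u ∈ K
    · simp only [huK, if_true]
      exact hKr _ (lead₂_mem u huK)
    · simp only [huK, if_false]
      exact h₁.lead_ne u ⟨hu, huK⟩ hur
  · intro u hu hur
    by_cases huK : u ∈ K
    · simp only [huK, if_true, lead₂_mem u huK]
      exact h₂.lead_lead u (hK u huK).1 (hK u huK).2
    · simp only [huK, if_false, (lead₁_mem u hu huK hur).2]
      exact h₁.lead_lead u ⟨hu, huK⟩ hur
  · intro u hu hur
    by_cases huK : u ∈ K
    · simp only [huK, if_true]
      exact h₂.adj u (hK u huK).1 (hK u huK).2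
    · simp only [huK, if_false]
      exact h₁.adj u ⟨hu, huK⟩ hur
  · intro u hu w hw hur hwr
    by_cases huK : u ∈ K <;> by_cases hwK : w ∈ K <;> simp only [huK, hwK, if_true, if_false] <;>
      intro h
    · have := h₂.const u (hK u huK).1 w (hK w hwK).1 (hK u huK).2 (hK w hwK).2 h
      exact ⟨this.1, by rw [this.2]⟩
    · exact absurd h (hlead_ne u hu w hw huK hwK hwr)
    · exact absurd h.symm (hlead_ne w hw u hu hwK huK hur)
    · exact h₁.const u ⟨hu, huK⟩ w ⟨hw, hwK⟩ hur hwr h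
  · intro u hu w hw huw
    have across : ∀ x ∈ K, ∀ y ∈ S, y ∉ K → G.Adj x y → root₂ x = y := by
      intro x hx y hy hyK hxy
      have hyv : y = v := (hedge x hx y hy hxy).resolve_left hyK
      subst hyv
      rcases h₂.edge x (hK x hx).1 y (Or.inl rfl) hxy with h | h | h
      · exact absurd rfl h.1
      · exact h.2
      · exact absurd rfl h.2.1
    by_cases huK : u ∈ K <;> by_cases hwK : w ∈ K <;> simp only [huK, hwK, if_true, if_false]
    · rcases h₂.edge u (hK u huK).1 w (hK w hwK).1 huw with h | h | h
      · exact Or.inl ⟨hKr w hwK, h.2⟩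
      · exact Or.inr (Or.inl ⟨hKr u huK, h.2⟩)
      · exact Or.inr (Or.inr ⟨hKr u huK, hKr w hwK, h.2.2⟩)
    · exact Or.inr (Or.inl ⟨hKr u huK, across u huK w hw hwK huw⟩)
    · exact Or.inl ⟨hKr w hwK, across w hwK u hu huK huw.symm⟩
    · exact h₁.edge u ⟨hu, huK⟩ w ⟨hw, hwK⟩ huw
  · intro u hu hur
    by_cases huK : u ∈ K
    · refine (congrArg (fun T => TwoConnected (G.induce T)) ?_).mpr
        (h₂.block u (hK u huK).1 (hK u huK).2)
      simp only [huK, if_true]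
      congr 1
      ext w
      constructor
      · rintro ⟨hw, hwr, h⟩
        by_cases hwK : w ∈ K
        · simp only [hwK, if_true] at h
          exact ⟨(hK w hwK).1, (hK w hwK).2, h⟩
        · simp only [hwK, if_false] at h
          exact absurd h.symm (hlead_ne u hu w hw huK hwK hwr)
      · rintro ⟨hw, hwv, h⟩
        have hwK : w ∈ K := hw.resolve_left hwv
        exact ⟨hKS hwK, hKr w hwK, by simp only [hwK, if_true]; exact h⟩
    · refine (congrArg (fun T => TwoConnected (G.induce T)) ?_).mpr
        (h₁.block u ⟨hu, huK⟩ hur)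
      simp only [huK, if_false]
      congr 1
      ext w
      constructor
      · rintro ⟨hw, hwr, h⟩
        by_cases hwK : w ∈ K
        · simp only [hwK, if_true] at h
          exact absurd h (hlead_ne w hw u hu hwK huK hur)
        · simp only [hwK, if_false] at h
          exact ⟨⟨hw, hwK⟩, hwr, h⟩
      · rintro ⟨hw, hwr, h⟩
        exact ⟨hw.1, hwr, by simp only [hw.2, if_false]; exact h⟩

/-- Induction on the size: split at a cut-vertex `v`, root the side avoiding `r` at `v`, and glue. A
set without cut-vertex is a single part, led by any neighbour of `r`. -/
theorem exists_blockDecomp [Finite V] (G : SimpleGraph V) (S : Set V) (r : V) (hr : r ∈ S)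
    (hS : (G.induce S).Connected) :
    ∃ lead root depth, BlockDecomp G S r lead root depth := by
  classical
  induction hn : S.ncard using Nat.strong_induction_on generalizing S r with
  | _ n ih =>
  have hpos : 0 < S.ncard := (Set.ncard_pos (Set.toFinite _)).2 ⟨r, hr⟩
  by_cases htwo : TwoConnected (G.induce S)
  · by_cases hex : ∃ z ∈ S, z ≠ r
    · obtain ⟨z, hz, hzr⟩ := hex
      have : Nontrivial S := ⟨⟨z, hz⟩, ⟨r, hr⟩, fun h => hzr (congrArg Subtype.val h)⟩
      obtain ⟨l, hl⟩ := hS.preconnected.exists_adj_of_nontrivial ⟨r, hr⟩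
      have hlr : G.Adj r l.1 := hl
      have hcard : 1 < S.ncard := (Set.one_lt_ncard (Set.toFinite _)).2 ⟨z, hz, r, hr, hzr⟩
      refine ⟨fun _ => l.1, fun _ => r, fun u => if u = r then 0 else 1, ?_⟩
      constructor
      · simp
      · intro u _ hur
        simp [hur]
      · intro u _ hur
        simp [hur]
      · intro u _
        split_ifs <;> omega
      · exact fun _ _ _ => hr
      · exact fun _ _ _ => l.2
      · exact fun _ _ _ => hlr.ne'
      · exact fun _ _ _ => rfl
      · exact fun _ _ _ => hlr
      · intro u _ w _ hur hwr _
        simp [hur, hwr]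
      · intro u _ w _ huw
        by_cases hur : u = r
        · exact Or.inl ⟨fun h => huw.ne (hur.trans h.symm), hur.symm⟩
        · by_cases hwr : w = r
          · exact Or.inr (Or.inl ⟨hur, hwr.symm⟩)
          · exact Or.inr (Or.inr ⟨hur, hwr, rfl⟩)
      · intro u _ _
        have : insert r {w | w ∈ S ∧ w ≠ r ∧ l.1 = l.1} = S := by
          ext w
          constructor
          · rintro (rfl | h)
            · exact hr
            · exact h.1
          · intro hw
            by_cases hwr : w = r
            · exact Or.inl hwr
            · exact Or.inr ⟨hw, hwr, rfl⟩
        rw [this]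
        exact htwo
    · push Not at hex
      refine ⟨id, id, fun _ => 0, ?_⟩
      constructor
      · rfl
      · exact fun u hu hur => absurd (hex u hu) hur
      · exact fun u hu hur => absurd (hex u hu) hur
      · exact fun u hu => hpos
      · exact fun u hu hur => absurd (hex u hu) hur
      · exact fun u hu hur => absurd (hex u hu) hur
      · exact fun u hu hur => absurd (hex u hu) hur
      · exact fun u hu hur => absurd (hex u hu) hur
      · exact fun u hu hur => absurd (hex u hu) hur
      · exact fun u hu w hw hur => absurd (hex u hu) hur
      · exact fun u hu w hw huw => absurd ((hex u hu).trans (hex w hw).symm) huw.ne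
      · exact fun u hu hur => absurd (hex u hu) hur
  · obtain ⟨v, hv, K, hKS, hvK, hrK, ⟨x, hx⟩, ⟨z, hz, hzK, hzv⟩, hedge⟩ :=
      exists_split (r := r) hS htwo
    have hTS : insert v K ⊆ S := Set.insert_subset hv hKS
    have he : ∀ x ∈ S, ∀ y ∈ S, G.Adj x y →
        (x ∈ insert v K ∧ y ∈ insert v K) ∨ (x ∈ S \ K ∧ y ∈ S \ K) := by
      intro x hx y hy hxy
      by_cases hxK : x ∈ K
      · exact Or.inl ⟨Or.inr hxK, (hedge x hxK y hy hxy).symm⟩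
      · by_cases hyK : y ∈ K
        · exact Or.inl ⟨(hedge y hyK x hx hxy.symm).symm, Or.inr hyK⟩
        · exact Or.inr ⟨⟨hx, hxK⟩, hy, hyK⟩
    have hTconn : (G.induce (insert v K)).Connected := by
      have := connected_induce_inter (X := insert v K) (Y := S \ K) hS hv (Or.inl rfl)
        (fun u hu hu' => hu.resolve_right hu'.2) he
      rwa [Set.inter_eq_right.2 hTS] at this
    have hSconn : (G.induce (S \ K)).Connected := by
      have := connected_induce_inter (X := S \ K) (Y := insert v K) hS hv ⟨hv, hvK⟩
        (fun u hu hu' => hu'.resolve_right hu.2) (fun x hx y hy hxy => (he x hx y hy hxy).symm)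
      rwa [Set.inter_eq_right.2 Set.sdiff_subset] at this
    obtain ⟨lead₂, root₂, depth₂, h₂⟩ := ih (insert v K).ncard (by
      rw [← hn]
      exact Set.ncard_lt_ncard ⟨hTS, fun h => (h hz).elim hzv hzK⟩ (Set.toFinite _))
      (insert v K) v (Or.inl rfl) hTconn rfl
    obtain ⟨lead₁, root₁, depth₁, h₁⟩ := ih (S \ K).ncard (by
      rw [← hn]
      exact Set.ncard_lt_ncard ⟨Set.sdiff_subset, fun h => (h (hKS hx)).2 hx⟩ (Set.toFinite _))
      (S \ K) r ⟨hr, hrK⟩ hSconn rfl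
    exact ⟨_, _, _, h₁.glue hKS hv hvK hrK hedge h₂⟩

end Decomposition

/-! ### Locally checkable interval numberings of spanning trees. -/

section Numbering

variable {V : Type*}

/-- A spanning tree of the set `P`, rooted at `l`, given by the parent function `par` and the
distances `lev` to the root, with an interval numbering: the interval of a vertex consists of its
own number `lo u` and, as a disjoint union, of the intervals of its children. -/
structure Numbering (G : SimpleGraph V) (P : Set V) (l : V) (par : V → V)
    (lev lo hi : V → ℕ) : Prop where
  mem : l ∈ P
  lev_root : lev l = 0
  -- The number 1 is reserved for the root of the block.
  lo_root : lo l = 2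
  lo_le : ∀ u ∈ P, lo u ≤ hi u
  par_mem : ∀ u ∈ P, u ≠ l → par u ∈ P
  par_adj : ∀ u ∈ P, u ≠ l → G.Adj u (par u)
  lev_par : ∀ u ∈ P, u ≠ l → lev u = lev (par u) + 1
  lo_par : ∀ u ∈ P, u ≠ l → lo (par u) < lo u
  hi_par : ∀ u ∈ P, u ≠ l → hi u ≤ hi (par u)
  children : ∀ u ∈ P, ∀ x, lo u < x → x ≤ hi u →
    ∃! w, (w ∈ P ∧ w ≠ l ∧ par w = u) ∧ lo w ≤ x ∧ x ≤ hi w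

variable {G : SimpleGraph V} {P : Set V} {l : V} {par : V → V} {lev lo hi : V → ℕ}

/-- To prove a property of all vertices of the tree, climb to the root. -/
theorem Numbering.induct (h : Numbering G P l par lev lo hi) {p : V → Prop} (hl : p l)
    (hstep : ∀ u ∈ P, u ≠ l → p (par u) → p u) : ∀ u ∈ P, p u := by
  intro u hu
  induction hn : lev u generalizing u with
  | zero =>
    by_cases hul : u = l
    · exact hul ▸ hl
    · have := h.lev_par u hu hul
      omega
  | succ n ih =>
    by_cases hul : u = l
    · exact hul ▸ hl
    · have := h.lev_par u hu hul
      exact hstep u hu hul (ih _ (h.par_mem u hu hul) (by omega))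

theorem Numbering.two_le_lo (h : Numbering G P l par lev lo hi) : ∀ u ∈ P, 2 ≤ lo u :=
  h.induct h.lo_root.ge fun u hu hul ih => ih.trans (h.lo_par u hu hul).le

theorem Numbering.hi_le (h : Numbering G P l par lev lo hi) : ∀ u ∈ P, hi u ≤ hi l :=
  h.induct le_rfl fun u hu hul ih => (h.hi_par u hu hul).trans ih

theorem Numbering.lev_le (h : Numbering G P l par lev lo hi) : ∀ u ∈ P, lev u ≤ lo u := by
  refine h.induct (by rw [h.lev_root]; exact Nat.zero_le _) fun u hu hul ih => ?_
  have h1 := h.lev_par u hu hul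
  have h2 := h.lo_par u hu hul
  omega

/-- Descend from `u` through the children whose intervals contain `x`; `lo` increases until it
equals `x`. -/
theorem Numbering.exists_lo_eq (h : Numbering G P l par lev lo hi) (x : ℕ) (u : V) (hu : u ∈ P)
    (h1 : lo u ≤ x) (h2 : x ≤ hi u) : ∃ w ∈ P, lo w = x := by
  induction hn : x - lo u using Nat.strong_induction_on generalizing u with
  | _ n ih =>
  rcases h1.eq_or_lt with h1 | h1
  · exact ⟨u, hu, h1⟩
  · obtain ⟨w, ⟨⟨hw, hwl, hwu⟩, hw1, hw2⟩, _⟩ := h.children u hu x h1 h2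
    have := h.lo_par w hw hwl
    rw [hwu] at this
    exact ih (x - lo w) (by omega) w hw hw1 hw2 rfl

/-- The intervals of both parents contain `x` too, so by induction the parents agree, and uniqueness
in `children` identifies `u` and `w`. -/
theorem Numbering.eq_of_lev_eq (h : Numbering G P l par lev lo hi) (x : ℕ) (u w : V)
    (hu : u ∈ P) (hw : w ∈ P) (huw : lev u = lev w) (hu1 : lo u ≤ x) (hu2 : x ≤ hi u)
    (hw1 : lo w ≤ x) (hw2 : x ≤ hi w) : u = w := by
  induction hn : lev u generalizing u w with
  | zero =>
    have root : ∀ v ∈ P, lev v = 0 → v = l := by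
      intro v hv hv0
      by_contra hvl
      have := h.lev_par v hv hvl
      omega
    rw [root u hu hn, root w hw (by omega)]
  | succ n ih =>
    have ne : ∀ v, lev v = n + 1 → v ≠ l := by
      rintro v hv rfl
      have := h.lev_root
      omega
    have hul := ne u hn
    have hwl := ne w (by omega)
    have a1 := h.lev_par u hu hul
    have a2 := h.lev_par w hw hwl
    have a3 := h.lo_par u hu hul
    have a4 := h.lo_par w hw hwl
    have a5 := h.hi_par u hu hul
    have a6 := h.hi_par w hw hwl
    have hpar := ih (par u) (par w) (h.par_mem u hu hul) (h.par_mem w hw hwl) (by omega)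
      (by omega) (by omega) (by omega) (by omega) (by omega)
    exact (h.children (par u) (h.par_mem u hu hul) x (by omega) (by omega)).unique
      ⟨⟨hu, hul, rfl⟩, hu1, hu2⟩ ⟨⟨hw, hwl, hpar.symm⟩, hw1, hw2⟩

theorem Numbering.exists_ancestor (h : Numbering G P l par lev lo hi) (j : ℕ) :
    ∀ w ∈ P, j < lev w → ∃ v ∈ P, lev v = j ∧ lo v < lo w ∧ hi w ≤ hi v := by
  refine h.induct ?_ fun u hu hul ih hj => ?_
  · intro hj
    have := h.lev_root
    omega
  · have a1 := h.lev_par u hu hul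
    have a2 := h.lo_par u hu hul
    have a3 := h.hi_par u hu hul
    by_cases hj' : lev (par u) = j
    · exact ⟨par u, h.par_mem u hu hul, hj', a2, a3⟩
    · obtain ⟨v, hv, h1, h2, h3⟩ := ih (by omega)
      exact ⟨v, hv, h1, by omega, by omega⟩

/-- If two vertices share a number but not a level, the ancestor of the deeper one on the level of
the other has that number in its interval, so it is the other one; but ancestors have strictly
smaller numbers. -/
theorem Numbering.injOn (h : Numbering G P l par lev lo hi) : Set.InjOn lo P := by
  have key : ∀ u ∈ P, ∀ w ∈ P, lo u = lo w → ¬ lev u < lev w := by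
    intro u hu w hw huw hlt
    obtain ⟨v, hv, h1, h2, h3⟩ := h.exists_ancestor (lev u) w hw hlt
    have a1 := h.lo_le u hu
    have a2 := h.lo_le w hw
    have := h.eq_of_lev_eq (lo u) v u hv hu h1 (by omega) (by omega) (by omega) (by omega)
    rw [this] at h2
    omega
  intro u hu w hw huw
  have h1 := key u hu w hw huw
  have h2 := key w hw u hu huw.symm
  have a1 := h.lo_le u hu
  have a2 := h.lo_le w hw
  exact h.eq_of_lev_eq (lo u) u w hu hw (by omega) le_rfl a1 (by omega) (by omega)

/-- All of `2, …, hi l` are numbers of vertices of `P`. Thus the range is bounded by the size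
without the size being certified. -/
theorem Numbering.hi_root_le (h : Numbering G P l par lev lo hi) (hP : P.Finite) :
    hi l ≤ P.ncard + 1 := by
  have hsub : (↑(Finset.Icc 2 (hi l)) : Set ℕ) ⊆ lo '' P := by
    intro x hx
    rw [Finset.coe_Icc, Set.mem_Icc] at hx
    obtain ⟨w, hw, hwx⟩ := h.exists_lo_eq x l h.mem (h.lo_root ▸ hx.1) hx.2
    exact ⟨w, hw, hwx⟩
  have h1 := Set.ncard_le_ncard hsub (hP.image _)
  rw [Set.ncard_coe_finset, Nat.card_Icc] at h1
  have h2 := Set.ncard_image_le (f := lo) hP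
  omega

theorem Numbering.lo_le_card (h : Numbering G P l par lev lo hi) (hP : P.Finite) {u : V}
    (hu : u ∈ P) : lo u ≤ P.ncard + 1 :=
  (h.lo_le u hu).trans ((h.hi_le u hu).trans (h.hi_root_le hP))

open Classical in
/-- A new leaf `z` is attached at `q`, as the first child of `q`. -/
theorem Numbering.insert_leaf (h : Numbering G P l par lev lo hi) {q z : V} (hq : q ∈ P)
    (hz : z ∉ P) (hzq : G.Adj z q) :
    Numbering G (insert z P) l (fun u => if u = z then q else par u)
      (fun u => if u = z then lev q + 1 else lev u)
      (fun u => if u = z then lo q + 1 else if lo u ≤ lo q then lo u else lo u + 1)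
      (fun u => if u = z then lo q + 1 else if hi u < lo q then hi u else hi u + 1) := by
  have hne : ∀ u ∈ P, u ≠ z := fun u hu h => hz (h ▸ hu)
  have hlz := hne l h.mem
  have hqz := hne q hq
  have hq1 := h.lo_le q hq
  have hparz : ∀ u ∈ P, u ≠ l → par u ≠ z := fun u hu hul => hne _ (h.par_mem u hu hul)
  constructor
  · exact Or.inr h.mem
  · simp only [hlz, if_false]
    exact h.lev_root
  · have := h.two_le_lo q hq
    simp only [hlz, if_false, h.lo_root, this, if_true]
  · rintro u (rfl | hu)
    · simp
    · have := h.lo_le u hu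
      simp only [hne u hu, if_false]
      split_ifs <;> omega
  · rintro u (rfl | hu) hul
    · simp only [if_true]
      exact Or.inr hq
    · simp only [hne u hu, if_false]
      exact Or.inr (h.par_mem u hu hul)
  · rintro u (rfl | hu) hul
    · simp only [if_true]
      exact hzq
    · simp only [hne u hu, if_false]
      exact h.par_adj u hu hul
  · rintro u (rfl | hu) hul
    · simp only [if_true, hqz, if_false]
    · simp only [hne u hu, hparz u hu hul, if_false]
      exact h.lev_par u hu hul
  · rintro u (rfl | hu) hul
    · simp only [if_true, hqz, if_false, le_refl]
      omega
    · have := h.lo_par u hu hul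
      simp only [hne u hu, hparz u hu hul, if_false]
      split_ifs <;> omega
  · rintro u (rfl | hu) hul
    · simp only [if_true, hqz, if_false]
      split_ifs <;> omega
    · have := h.hi_par u hu hul
      simp only [hne u hu, hparz u hu hul, if_false]
      split_ifs <;> omega
  · rintro u (rfl | hu) x hx1 hx2
    · simp only [if_true] at hx1 hx2
      omega
    · simp only [hne u hu, if_false] at hx1 hx2
      -- the children of `u` whose old interval contains `y` are those whose new one contains `x`
      have old : ∀ y, lo u < y → y ≤ hi u →
          (∀ w ∈ P, w ≠ l → par w = u → ((lo w ≤ y ∧ y ≤ hi w) ↔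
            ((if lo w ≤ lo q then lo w else lo w + 1) ≤ x ∧
              x ≤ (if hi w < lo q then hi w else hi w + 1)))) →
          (q = u → x ≠ lo q + 1) →
          ∃! w, (w ∈ insert z P ∧ w ≠ l ∧ (if w = z then q else par w) = u) ∧
            (if w = z then lo q + 1 else if lo w ≤ lo q then lo w else lo w + 1) ≤ x ∧
            x ≤ (if w = z then lo q + 1 else if hi w < lo q then hi w else hi w + 1) := by
        intro y hy1 hy2 hiff hxq
        obtain ⟨w, ⟨⟨hw, hwl, hwu⟩, hwy⟩, huniq⟩ := h.children u hu y hy1 hy2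
        refine ⟨w, ⟨⟨Or.inr hw, hwl, ?_⟩, ?_⟩, ?_⟩
        · simpa only [hne w hw, if_false] using hwu
        · simpa only [hne w hw, if_false] using (hiff w hw hwl hwu).1 hwy
        · rintro w' ⟨⟨rfl | hw', hwl', hwu'⟩, hwx'⟩
          · simp only [if_true] at hwu' hwx'
            exact absurd (by omega) (hxq hwu')
          · simp only [hne w' hw', if_false] at hwu' hwx'
            exact huniq w' ⟨⟨hw', hwl', hwu'⟩, (hiff w' hw' hwl' hwu').2 hwx'⟩
      -- The new number is `lo q + 1`. Below it positions are unchanged, above it they are shifted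
      -- by one; at it, the child of `u` is `z` if `u = q`, and otherwise the one whose interval
      -- contained `lo q`.
      rcases lt_trichotomy x (lo q + 1) with hx | hx | hx
      · refine old x (by split_ifs at hx1 <;> omega) (by split_ifs at hx2 <;> omega) ?_
          (fun _ => by omega)
        intro w _ _ _
        split_ifs <;> omega
      · by_cases huq : u = q
        · subst huq
          refine ⟨z, ⟨⟨Or.inl rfl, fun h => hlz h.symm, by simp⟩, by simp [hx]⟩, ?_⟩
          rintro w ⟨⟨rfl | hw, hwl, hwu⟩, hwx, _⟩
          · rfl
          · exfalso
            simp only [hne w hw, if_false] at hwu hwx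
            have := h.lo_par w hw hwl
            rw [hwu] at this
            split_ifs at hwx <;> omega
        · have hlo : lo u ≠ lo q := fun e => huq (h.injOn hu hq e)
          refine old (lo q) (by split_ifs at hx1 <;> omega) (by split_ifs at hx2 <;> omega) ?_
            (fun e => absurd e.symm huq)
          intro w _ _ _
          split_ifs <;> omega
      · refine old (x - 1) (by split_ifs at hx1 <;> omega) (by split_ifs at hx2 <;> omega) ?_
          (fun _ => by omega)
        intro w _ _ _
        split_ifs <;> omega

/-- Grow the tree from `l` leaf by leaf: while it misses a vertex of `P`, connectedness gives an
edge leaving it. -/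
theorem exists_numbering [Finite V] (hP : (G.induce P).Connected) (hl : l ∈ P) :
    ∃ par lev lo hi, Numbering G P l par lev lo hi := by
  have main : ∀ n < P.ncard, ∃ Q ⊆ P, Q.ncard = n + 1 ∧
      ∃ par lev lo hi, Numbering G Q l par lev lo hi := by
    intro n
    induction n with
    | zero =>
      intro _
      refine ⟨{l}, Set.singleton_subset_iff.2 hl, Set.ncard_singleton l, fun _ => l, fun _ => 0,
        fun _ => 2, fun _ => 2, ?_⟩
      constructor
      · exact rfl
      · rfl
      · rfl
      · exact fun _ _ => le_rfl
      · exact fun u hu hul => absurd hu hul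
      · exact fun u hu hul => absurd hu hul
      · exact fun u hu hul => absurd hu hul
      · exact fun u hu hul => absurd hu hul
      · exact fun u hu hul => absurd hu hul
      · intro u hu x h1 h2
        omega
    | succ n ih =>
      intro hn
      obtain ⟨Q, hQP, hQ, par, lev, lo, hi, h⟩ := ih (by omega)
      obtain ⟨z₀, hz₀, hz₀Q⟩ : ∃ z ∈ P, z ∉ Q := by
        by_contra! hcon
        have := Set.ncard_le_ncard (s := P) (t := Q) hcon (Set.toFinite _)
        omega
      obtain ⟨q, hqP, z, hzP, hqQ, hzQ, hqz⟩ : ∃ q ∈ P, ∃ z ∈ P, q ∈ Q ∧ z ∉ Q ∧ G.Adj q z := by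
        by_contra! hcon
        refine hz₀Q (reachable_induction (G := G.induce P) (p := fun u => u.1 ∈ Q) ?_
          (hP.preconnected ⟨l, hl⟩ ⟨z₀, hz₀⟩) h.mem)
        intro u v huv hu
        by_contra hv
        exact hcon u.1 u.2 v.1 v.2 hu hv huv
      refine ⟨insert z Q, Set.insert_subset hzP hQP, ?_, _, _, _, _,
        h.insert_leaf hqQ hzQ hqz.symm⟩
      rw [Set.ncard_insert_of_notMem hzQ, hQ]
  have hpos : 0 < P.ncard := (Set.ncard_pos (Set.toFinite _)).2 ⟨l, hl⟩
  obtain ⟨Q, hQP, hQ, h⟩ := main (P.ncard - 1) (by omega)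
  rwa [Set.eq_of_subset_of_ncard_le hQP (by omega)] at h

end Numbering

/-! ### Records as bit strings, and their length. -/

section Encoding

/-- The information stored at a vertex: the depth of its part, the identifiers of the leader and
of the root of the part, the identifier of its parent in the spanning tree of the part, its level
and interval in that tree, and the certificates of itself and of the root in the block. -/
structure VertexRecord where
  depth : ℕ
  lead : ℕ
  root : ℕ
  par : ℕ
  lev : ℕ
  lo : ℕ
  hi : ℕ
  cert : Certificate
  rootCert : Certificate

instance : Inhabited VertexRecord := ⟨⟨0, 0, 0, 0, 0, 0, 0, [], []⟩⟩

/-- The pair of two bit strings as one bit string. -/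
def pack : List Bool → List Bool → List Bool
  | [], t => false :: t
  | x :: s, t => true :: x :: pack s t

theorem pack_injective {s t s' t' : List Bool} (h : pack s t = pack s' t') :
    s = s' ∧ t = t' := by
  induction s generalizing s' with
  | nil =>
    cases s' with
    | nil => simpa [pack] using h
    | cons x s' => simp [pack] at h
  | cons x s ih =>
    cases s' with
    | nil => simp [pack] at h
    | cons x' s' =>
      simp only [pack, List.cons.injEq, true_and] at h
      obtain ⟨h1, h2⟩ := ih h.2
      exact ⟨by rw [h.1, h1], h2⟩

theorem length_pack (s t : List Bool) : (pack s t).length = 2 * s.length + 1 + t.length := by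
  induction s with
  | nil => simp [pack, Nat.add_comm]
  | cons x s ih => simp only [pack, List.length_cons, ih]; omega

theorem bits_injective : Function.Injective Nat.bits := by
  intro m n h
  have h' := congrArg (List.map fun b : Bool => cond b 1 0) h
  rw [← Nat.digits_two_eq_bits, ← Nat.digits_two_eq_bits] at h'
  exact Nat.digits_inj_iff.1 h'

/-- The bit string that stores a record. -/
def VertexRecord.encode (R : VertexRecord) : Certificate :=
  pack R.depth.bits <| pack R.lead.bits <| pack R.root.bits <| pack R.par.bits <|
    pack R.lev.bits <| pack R.lo.bits <| pack R.hi.bits <| pack R.cert R.rootCert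

theorem VertexRecord.encode_injective : Function.Injective VertexRecord.encode := by
  intro R R' h
  obtain ⟨h1, h⟩ := pack_injective h
  obtain ⟨h2, h⟩ := pack_injective h
  obtain ⟨h3, h⟩ := pack_injective h
  obtain ⟨h4, h⟩ := pack_injective h
  obtain ⟨h5, h⟩ := pack_injective h
  obtain ⟨h6, h⟩ := pack_injective h
  obtain ⟨h7, h⟩ := pack_injective h
  obtain ⟨h8, h9⟩ := pack_injective h
  cases R
  cases R'
  simp only [VertexRecord.mk.injEq]
  exact ⟨bits_injective h1, bits_injective h2, bits_injective h3, bits_injective h4,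
    bits_injective h5, bits_injective h6, bits_injective h7, h8, h9⟩

/-- The record stored in a bit string. -/
noncomputable def VertexRecord.decode : Certificate → VertexRecord :=
  Function.invFun VertexRecord.encode

theorem VertexRecord.decode_encode (R : VertexRecord) : decode R.encode = R :=
  Function.leftInverse_invFun encode_injective R

/-- Each `pack` doubles its first argument and adds one bit: the seven numbers and `cert` are
doubled, `rootCert` is not. -/
theorem VertexRecord.length_encode_le {R : VertexRecord} {s b : ℕ} (h1 : R.depth < 2 ^ s)
    (h2 : R.lead < 2 ^ s) (h3 : R.root < 2 ^ s) (h4 : R.par < 2 ^ s) (h5 : R.lev < 2 ^ s)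
    (h6 : R.lo < 2 ^ s) (h7 : R.hi < 2 ^ s) (h8 : R.cert.length ≤ b)
    (h9 : R.rootCert.length ≤ b) : R.encode.length ≤ 14 * s + 3 * b + 8 := by
  rw [← Nat.size_le] at h1 h2 h3 h4 h5 h6 h7
  simp only [encode, length_pack, Nat.size_eq_bits_len]
  omega

/-- All the fields of a record have length `O(f + log n)`. -/
theorem VertexRecord.length_encode_le_log {R : VertexRecord} {k n b : ℕ} (hk : 1 ≤ k)
    (hn : 2 ≤ n) (h1 : R.depth ≤ n ^ k + 1) (h2 : R.lead ≤ n ^ k + 1) (h3 : R.root ≤ n ^ k + 1)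
    (h4 : R.par ≤ n ^ k + 1) (h5 : R.lev ≤ n ^ k + 1) (h6 : R.lo ≤ n ^ k + 1)
    (h7 : R.hi ≤ n ^ k + 1) (h8 : R.cert.length ≤ b) (h9 : R.rootCert.length ≤ b) :
    R.encode.length ≤ (28 * k + 22) * (b + Nat.log 2 n) := by
  set L := Nat.log 2 n with hL
  have hL1 : 1 ≤ L := Nat.log_pos (by norm_num) hn
  have hlt : n ^ k + 1 < 2 ^ (k * (L + 1) + 1) := by
    have h := Nat.pow_lt_pow_left (Nat.lt_pow_succ_log_self (b := 2) (by norm_num) n)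
      (show k ≠ 0 by omega)
    rw [← pow_mul, Nat.mul_comm] at h
    have h' : 2 ≤ n ^ k := hn.trans (Nat.le_self_pow (by omega) n)
    rw [pow_succ]
    have h'' : n ^ k < 2 ^ (k * (L + 1)) := h
    omega
  have := VertexRecord.length_encode_le (h1.trans_lt hlt) (h2.trans_lt hlt) (h3.trans_lt hlt)
    (h4.trans_lt hlt) (h5.trans_lt hlt) (h6.trans_lt hlt) (h7.trans_lt hlt) h8 h9
  -- By `1 ≤ L`, the bound `14 * (k * (L + 1) + 1) + 3 * b + 8` is at most `28 * k * L + 22 * L + 3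
  -- * b`.
  have hkL : k ≤ k * L := Nat.le_mul_of_pos_right k hL1
  have e1 : k * (L + 1) = k * L + k := by ring
  have e2 : (28 * k + 22) * (b + L) = 28 * (k * b) + 28 * (k * L) + 22 * b + 22 * L := by ring
  rw [e2]
  omega

end Encoding

/-! ### The local checks and the simulation inside a block. -/

section Check

variable {V : Type} [Fintype V]

open Classical in
/-- What a vertex sees of the records of its neighbors. -/
noncomputable def recordView (G : SimpleGraph V) (ids : V → ℕ) (D : V → VertexRecord) (v : V) :
    Finset (ℕ × VertexRecord) :=
  (Finset.univ.filter (fun u => G.Adj v u)).image (fun u => (ids u, D u))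

theorem mem_recordView {G : SimpleGraph V} {ids : V → ℕ} {D : V → VertexRecord} {v : V}
    {p : ℕ × VertexRecord} : p ∈ recordView G ids D v ↔ ∃ u, G.Adj v u ∧ (ids u, D u) = p := by
  simp [recordView]

theorem recordView_mem {G : SimpleGraph V} (ids : V → ℕ) (D : V → VertexRecord) {v u : V}
    (h : G.Adj v u) : (ids u, D u) ∈ recordView G ids D v :=
  mem_recordView.2 ⟨u, h, rfl⟩

open Classical in
theorem recordView_comp (G : SimpleGraph V) (ids : V → ℕ) (dec : Certificate → VertexRecord)
    (c : V → Certificate) (v : V) :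
    (neighborView G ids c v).image (fun p => (p.1, dec p.2)) =
      recordView G ids (fun u => dec (c u)) v := by
  simp only [neighborView, recordView, Finset.image_image]
  rfl

/-- The neighbor `p` is a non-root vertex in the part described by `R`. -/
def SamePart (R : VertexRecord) (p : ℕ × VertexRecord) : Prop :=
  p.2.depth ≠ 0 ∧ p.2.lead = R.lead

open Classical in
/-- The identifiers and certificates, in the block, of the neighbors in the part of `R`. -/
noncomputable def partView (R : VertexRecord) (N : Finset (ℕ × VertexRecord)) :
    Finset (ℕ × Certificate) :=
  (N.filter (SamePart R)).image (fun p => (p.2.lo, p.2.cert))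

open Classical in
/-- The identifier and certificate, in the block, of the root of the part, if it is a neighbor. -/
noncomputable def rootView (R : VertexRecord) (N : Finset (ℕ × VertexRecord)) :
    Finset (ℕ × Certificate) :=
  (N.filter (fun p => p.1 = R.root)).image (fun _ => (1, R.rootCert))

/-- The conditions that a vertex with identifier `i` and record `R` checks when it sees the
records `N`. In the last two it simulates the verifier `A` in its own block, and in the blocks of
which it is the root. -/
structure LocalCheck (A : Verifier) (i : ℕ) (R : VertexRecord) (N : Finset (ℕ × VertexRecord)) :
    Prop where
  edge_root : R.depth = 0 → ∀ p ∈ N, p.2.depth ≠ 0 ∧ p.2.root = i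
  edge : R.depth ≠ 0 → ∀ p ∈ N,
    (p.2.depth ≠ 0 ∧ p.2.root = i) ∨ p.1 = R.root ∨ SamePart R p
  const : R.depth ≠ 0 → ∀ p ∈ N, SamePart R p →
    p.2.root = R.root ∧ p.2.depth = R.depth ∧ p.2.rootCert = R.rootCert
  depth_lt : R.depth ≠ 0 → ∀ p ∈ N, p.1 = R.root → p.2.depth < R.depth
  leader : R.depth ≠ 0 → i = R.lead → R.lev = 0 ∧ R.lo = 2 ∧ ∃ p ∈ N, p.1 = R.root
  parent : R.depth ≠ 0 → i ≠ R.lead → ∃ p ∈ N, SamePart R p ∧ p.1 = R.par ∧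
    R.lev = p.2.lev + 1 ∧ p.2.lo < R.lo ∧ R.hi ≤ p.2.hi
  lo_le : R.depth ≠ 0 → R.lo ≤ R.hi
  children : R.depth ≠ 0 → ∀ x, R.lo < x → x ≤ R.hi →
    ∃! p, (p ∈ N ∧ SamePart R p ∧ p.1 ≠ R.lead ∧ p.2.par = i) ∧ p.2.lo ≤ x ∧ x ≤ p.2.hi
  simulate : R.depth ≠ 0 → A (R.lo, R.cert) (partView R N ∪ rootView R N) = true
  -- The root reads its own certificate for the block off the neighbour `p`.
  simulate_root : ∀ p ∈ N, p.2.depth ≠ 0 → p.2.root = i →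
    A (1, p.2.rootCert) (partView p.2 N) = true

open Classical in
/-- The identifiers used in a block: the root gets `1`, the other vertices their numbers. -/
noncomputable def blockIds (r : V) (lo : V → ℕ) (B : Set V) (x : B) : ℕ :=
  if x.1 = r then 1 else lo x

open Classical in
/-- The certificates used in a block. -/
noncomputable def blockCert (r : V) (cert : V → Certificate) (rc : Certificate) (B : Set V)
    (x : B) : Certificate :=
  if x.1 = r then rc else cert x

variable {G : SimpleGraph V} {ids : V → ℕ} {D : V → VertexRecord} {P : Set V} {r : V}
  {R : VertexRecord}

theorem mem_partView {v : V} {q : ℕ × Certificate} :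
    q ∈ partView R (recordView G ids D v) ↔
      ∃ u, G.Adj v u ∧ SamePart R (ids u, D u) ∧ ((D u).lo, (D u).cert) = q := by
  simp only [partView, Finset.mem_image, Finset.mem_filter, mem_recordView]
  constructor
  · rintro ⟨p, ⟨⟨u, hu, rfl⟩, h⟩, rfl⟩
    exact ⟨u, hu, h, rfl⟩
  · rintro ⟨u, hu, h, rfl⟩
    exact ⟨_, ⟨⟨u, hu, rfl⟩, h⟩, rfl⟩

theorem mem_rootView {v : V} {q : ℕ × Certificate} :
    q ∈ rootView R (recordView G ids D v) ↔
      ∃ u, G.Adj v u ∧ ids u = R.root ∧ (1, R.rootCert) = q := by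
  simp only [rootView, Finset.mem_image, Finset.mem_filter, mem_recordView]
  constructor
  · rintro ⟨p, ⟨⟨u, hu, rfl⟩, h⟩, rfl⟩
    exact ⟨u, hu, h, rfl⟩
  · rintro ⟨u, hu, h, rfl⟩
    exact ⟨_, ⟨⟨u, hu, rfl⟩, h⟩, rfl⟩

theorem mem_neighborView_induce {V : Type} {G : SimpleGraph V} {B : Set V} [Fintype B]
    {i : B → ℕ} {c : B → Certificate} {v : B}
    {q : ℕ × Certificate} : q ∈ neighborView (G.induce B) i c v ↔
      ∃ u, ∃ hu : u ∈ B, G.Adj v.1 u ∧ (i ⟨u, hu⟩, c ⟨u, hu⟩) = q := by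
  simp [neighborView]

theorem neighborView_block_root [Fintype ↥(insert r P)]
    (hP : ∀ x, SamePart R (ids x, D x) ↔ x ∈ P) (rc : Certificate) (v : ↥(insert r P))
    (hv : v.1 = r) :
    neighborView (G.induce (insert r P)) (blockIds r (fun x => (D x).lo) _)
        (blockCert r (fun x => (D x).cert) rc _) v =
      partView R (recordView G ids D r) := by
  ext q
  rw [mem_neighborView_induce, mem_partView, hv]
  constructor
  · rintro ⟨u, hu, huv, rfl⟩
    have hur : u ≠ r := huv.ne'
    refine ⟨u, huv, (hP u).2 (hu.resolve_left hur), ?_⟩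
    simp only [blockIds, blockCert, hur, if_false]
  · rintro ⟨u, huv, hu, rfl⟩
    have hur : u ≠ r := huv.ne'
    refine ⟨u, Or.inr ((hP u).1 hu), huv, ?_⟩
    simp only [blockIds, blockCert, hur, if_false]

theorem neighborView_block [Fintype ↥(insert r P)] (hrP : r ∉ P)
    (hP : ∀ x, SamePart R (ids x, D x) ↔ x ∈ P) (hr : ∀ x, ids x = R.root ↔ x = r)
    (v : ↥(insert r P)) :
    neighborView (G.induce (insert r P)) (blockIds r (fun x => (D x).lo) _)
        (blockCert r (fun x => (D x).cert) R.rootCert _) v =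
      partView R (recordView G ids D v) ∪ rootView R (recordView G ids D v) := by
  ext q
  rw [mem_neighborView_induce, Finset.mem_union, mem_partView, mem_rootView]
  constructor
  · rintro ⟨u, hu, huv, rfl⟩
    by_cases hur : u = r
    · refine Or.inr ⟨u, huv, (hr u).2 hur, ?_⟩
      simp only [blockIds, blockCert, hur, if_true]
    · refine Or.inl ⟨u, huv, (hP u).2 (hu.resolve_left hur), ?_⟩
      simp only [blockIds, blockCert, hur, if_false]
  · rintro (⟨u, huv, hu, rfl⟩ | ⟨u, huv, hu, rfl⟩)
    · have huP := (hP u).1 hu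
      have hur : u ≠ r := fun h => hrP (h ▸ huP)
      refine ⟨u, Or.inr huP, huv, ?_⟩
      simp only [blockIds, blockCert, hur, if_false]
    · have hur := (hr u).1 hu
      refine ⟨u, Or.inl hur, huv, ?_⟩
      simp only [blockIds, blockCert, hur, if_true]

/-- Acceptance in a block, in terms of the records. -/
theorem accepts_block_iff [Fintype ↥(insert r P)] (A : Verifier) (hrP : r ∉ P)
    {rc : Certificate} (hP : ∀ x ∈ P, ∀ y, SamePart (D x) (ids y, D y) ↔ y ∈ P)
    (hr : ∀ x ∈ P, ∀ y, ids y = (D x).root ↔ y = r) (hrc : ∀ x ∈ P, (D x).rootCert = rc)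
    {l : V} (hl : l ∈ P) :
    Accepts A (G.induce (insert r P)) (blockIds r (fun x => (D x).lo) _)
        (blockCert r (fun x => (D x).cert) rc _) ↔
      (A (1, rc) (partView (D l) (recordView G ids D r)) = true ∧
        ∀ x ∈ P, A ((D x).lo, (D x).cert)
          (partView (D x) (recordView G ids D x) ∪ rootView (D x) (recordView G ids D x)) =
            true) := by
  have e1 : ∀ v : ↥(insert r P), v.1 = r →
      A (blockIds r (fun x => (D x).lo) _ v, blockCert r (fun x => (D x).cert) rc _ v)
        (neighborView (G.induce (insert r P)) (blockIds r (fun x => (D x).lo) _)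
          (blockCert r (fun x => (D x).cert) rc _) v) =
      A (1, rc) (partView (D l) (recordView G ids D r)) := by
    intro v hv
    rw [neighborView_block_root (hP l hl) rc v hv]
    simp only [blockIds, blockCert, hv, if_true]
  have e2 : ∀ v : ↥(insert r P), v.1 ∈ P →
      A (blockIds r (fun x => (D x).lo) _ v, blockCert r (fun x => (D x).cert) rc _ v)
        (neighborView (G.induce (insert r P)) (blockIds r (fun x => (D x).lo) _)
          (blockCert r (fun x => (D x).cert) rc _) v) =
      A ((D v).lo, (D v).cert)
          (partView (D v) (recordView G ids D v) ∪ rootView (D v) (recordView G ids D v)) := by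
    intro v hv
    have hvr : v.1 ≠ r := fun h => hrP (h ▸ hv)
    have := neighborView_block (G := G) (ids := ids) hrP (hP v hv) (hr v hv) v
    rw [hrc v hv] at this
    rw [this]
    simp only [blockIds, blockCert, hvr, if_false]
  constructor
  · intro h
    refine ⟨?_, fun x hx => ?_⟩
    · rw [← e1 ⟨r, Or.inl rfl⟩ rfl]
      exact h _
    · rw [← e2 ⟨x, Or.inr hx⟩ hx]
      exact h _
  · rintro ⟨h1, h2⟩ v
    rcases v.2 with hv | hv
    · rw [e1 v hv]
      exact h1
    · rw [e2 v hv]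
      exact h2 v hv

end Check

/-! ### Soundness: accepted records exclude the minor. -/

section Soundness

variable {V : Type} {G : SimpleGraph V} {P : Set V} {r l : V} {par : V → V} {lev lo hi : V → ℕ}

/-- The numbers in `P` are distinct and lie between 2 and `P.ncard + 1`, which is the size of the
block; the root takes 1. -/
theorem Numbering.validIds [Finite V] [Fintype ↥(insert r P)] {k : ℕ} (hk : 1 ≤ k)
    (h : Numbering G P l par lev lo hi) (hrP : r ∉ P) :
    ValidIds k (blockIds r lo (insert r P)) := by
  have hcard : Fintype.card ↥(insert r P) = P.ncard + 1 := by
    rw [← Nat.card_eq_fintype_card, Nat.card_coe_set_eq, Set.ncard_insert_of_notMem hrP]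
  have hbase : ∀ x : ↥(insert r P), x.1 ≠ r → x.1 ∈ P := fun x hx => x.2.resolve_left hx
  constructor
  · intro x y hxy
    simp only [blockIds] at hxy
    split_ifs at hxy with hx hy hy
    · exact Subtype.ext (hx.trans hy.symm)
    · have := h.two_le_lo y (hbase y hy)
      omega
    · have := h.two_le_lo x (hbase x hx)
      omega
    · exact Subtype.ext (h.injOn (hbase x hx) (hbase y hy) hxy)
  · intro x
    rw [hcard]
    have hpow : P.ncard + 1 ≤ (P.ncard + 1) ^ k := Nat.le_self_pow (by omega) _
    simp only [blockIds]
    split_ifs with hx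
    · omega
    · have h1 := h.two_le_lo x (hbase x hx)
      have h2 := h.lo_le_card (Set.toFinite _) (hbase x hx)
      omega

/-- Parents lead to `l` and then to `r`. The given verifier promises nothing on disconnected graphs,
so the tree is needed here as well. -/
theorem Numbering.connected_insert (h : Numbering G P l par lev lo hi) (hlr : G.Adj l r) :
    (G.induce (insert r P)).Connected := by
  have main : ∀ u ∈ P, ∀ hu : u ∈ insert r P,
      (G.induce (insert r P)).Reachable ⟨u, hu⟩ ⟨r, Or.inl rfl⟩ := by
    refine h.induct ?_ ?_
    · intro hu
      exact Adj.reachable (by exact hlr)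
    · intro u hu hul ih hu'
      have hadj : (G.induce (insert r P)).Adj ⟨u, hu'⟩
        ⟨par u, Or.inr (h.par_mem u hu hul)⟩ := h.par_adj u hu hul
      exact hadj.reachable.trans (ih _)
  have main' : ∀ u : ↥(insert r P), (G.induce (insert r P)).Reachable u ⟨r, Or.inl rfl⟩ := by
    rintro ⟨u, rfl | hu⟩
    · exact Reachable.refl _
    · exact main u hu _
  have : Nonempty ↥(insert r P) := ⟨⟨r, Or.inl rfl⟩⟩
  exact ⟨fun u v => (main' u).trans (main' v).symm⟩

variable [Fintype V] {ids : V → ℕ} {D : V → VertexRecord} {A : Verifier}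

/-- Climbing in the spanning tree of a part one reaches its leader. -/
theorem exists_leader (hD : ∀ v, LocalCheck A (ids v) (D v) (recordView G ids D v)) (w : V)
    (hw : (D w).depth ≠ 0) : ∃ l, ids l = (D w).lead ∧ (D l).lead = (D w).lead ∧
      (D l).root = (D w).root ∧ (D l).depth = (D w).depth ∧ (D l).rootCert = (D w).rootCert := by
  induction hn : (D w).lev using Nat.strong_induction_on generalizing w with
  | _ n ih =>
  by_cases hl : ids w = (D w).lead
  · exact ⟨w, hl, rfl, rfl, rfl, rfl⟩
  · obtain ⟨p, hp, hsame, _, hlev, _⟩ := (hD w).parent hw hl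
    have hc := (hD w).const hw p hp hsame
    obtain ⟨u, _, rfl⟩ := mem_recordView.1 hp
    simp only at hc hlev
    obtain ⟨l, h1, h2, h3, h4, h5⟩ := ih (D u).lev (by omega) u hsame.1 rfl
    have h6 : (D u).lead = (D w).lead := hsame.2
    exact ⟨l, h1.trans h6, h2.trans h6, h3.trans hc.1, h4.trans hc.2.1, h5.trans hc.2.2⟩

/-- Vertices of a part need not be adjacent, but both climb to the one vertex whose identifier is
the common `lead`, and the data do not change on the way. -/
theorem part_const (hids : Function.Injective ids)
    (hD : ∀ v, LocalCheck A (ids v) (D v) (recordView G ids D v)) (u w : V)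
    (hu : (D u).depth ≠ 0) (hw : (D w).depth ≠ 0) (huw : (D u).lead = (D w).lead) :
    (D u).root = (D w).root ∧ (D u).depth = (D w).depth ∧ (D u).rootCert = (D w).rootCert := by
  obtain ⟨l, h1, _, h3, h4, h5⟩ := exists_leader hD u hu
  obtain ⟨l', h1', _, h3', h4', h5'⟩ := exists_leader hD w hw
  have : l = l' := hids (by rw [h1, h1', huw])
  subst this
  exact ⟨h3.symm.trans h3', h4.symm.trans h4', h5.symm.trans h5'⟩

/-- The records define parts as in `minorFree_of_parts`; on each part with its root, the checked
numbering gives connectedness and valid identifiers, so `hA` applies. -/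
theorem minorFree_of_localCheck {k : ℕ} (hk : 1 ≤ k) {W : Type*} [Nontrivial W]
    {H : SimpleGraph W} (hH : TwoConnected H)
    (hA : ∀ (V : Type) [Fintype V] (G : SimpleGraph V), G.Connected → ∀ ids : V → ℕ,
      ValidIds k ids → ∀ c, Accepts A G ids c → MinorFree H G)
    (hids : Function.Injective ids)
    (hD : ∀ v, LocalCheck A (ids v) (D v) (recordView G ids D v)) : MinorFree H G := by
  rcases isEmpty_or_nonempty V with hV | hV
  · rintro ⟨B, hB, _⟩
    obtain ⟨a⟩ := hH.1.nonempty
    obtain ⟨x⟩ := (hB a).nonempty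
    exact hV.false x.1
  let vert : ℕ → V := Function.invFun ids
  have hvert : ∀ v, vert (ids v) = v := Function.leftInverse_invFun hids
  -- A claimed root identifier might belong to no vertex; the leader, having seen it on a neighbour,
  -- rules this out.
  have hleader : ∀ u, (D u).depth ≠ 0 → ∃ l, ids l = (D u).lead ∧ (D l).depth ≠ 0 ∧
      (D l).lead = (D u).lead ∧ G.Adj l (vert (D u).root) ∧
      ids (vert (D u).root) = (D u).root ∧ (D (vert (D u).root)).depth < (D u).depth := by
    intro u hu
    obtain ⟨l, h1, h2, h3, h4, _⟩ := exists_leader hD u hu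
    have hl : (D l).depth ≠ 0 := h4 ▸ hu
    obtain ⟨_, _, p, hp, hpr⟩ := (hD l).leader hl (h1.trans h2.symm)
    have hlt := (hD l).depth_lt hl p hp hpr
    obtain ⟨r, hr, rfl⟩ := mem_recordView.1 hp
    have hrr : ids r = (D u).root := hpr.trans h3
    rw [← hrr, hvert]
    exact ⟨l, h1, hl, h2, hr, rfl, h4 ▸ hlt⟩
  have hroot : ∀ u, (D u).depth ≠ 0 → (D (vert (D u).root)).depth < (D u).depth := by
    intro u hu
    obtain ⟨l, _, _, _, _, _, h⟩ := hleader u hu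
    exact h
  refine minorFree_of_parts hH (fun u => (D u).depth) (fun u => (D u).lead)
    (fun u => vert (D u).root) hroot ?_ ?_ ?_
  · intro u w hu hw huw
    obtain ⟨h1, h2, _⟩ := part_const hids hD u w hu hw huw
    exact ⟨by rw [h1], h2⟩
  · intro u w huw
    have hmem := recordView_mem ids D huw
    by_cases hu : (D u).depth = 0
    · obtain ⟨h1, h2⟩ := (hD u).edge_root hu _ hmem
      exact Or.inl ⟨h1, (congrArg vert h2).trans (hvert u)⟩
    · rcases (hD u).edge hu _ hmem with ⟨h1, h2⟩ | h | h
      · exact Or.inl ⟨h1, (congrArg vert h2).trans (hvert u)⟩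
      · exact Or.inr (Or.inl ⟨hu, (congrArg vert h.symm).trans (hvert w)⟩)
      · exact Or.inr (Or.inr ⟨hu, h.1, h.2.symm⟩)
  · intro u hu
    obtain ⟨l, hl, hld, hll, hlr, hir, hrd⟩ := hleader u hu
    set r := vert (D u).root with hr
    set P : Set V := {w | (D w).depth ≠ 0 ∧ (D w).lead = (D u).lead} with hP
    have hlP : l ∈ P := ⟨hld, hll⟩
    have hconst : ∀ w ∈ P, (D w).root = (D u).root ∧ (D w).depth = (D u).depth ∧
        (D w).rootCert = (D u).rootCert := fun w hw => part_const hids hD w u hw.1 hu hw.2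
    have hrP : r ∉ P := fun h => by
      have := (hconst r h).2.1
      omega
    have hidl : ∀ w ∈ P, w ≠ l → ids w ≠ (D w).lead := fun w hw hwl h =>
      hwl (hids (h.trans (hw.2.trans hl.symm)))
    have hpar : ∀ w ∈ P, w ≠ l → vert (D w).par ∈ P ∧ G.Adj w (vert (D w).par) ∧
        ids (vert (D w).par) = (D w).par ∧
        (D w).lev = (D (vert (D w).par)).lev + 1 ∧ (D (vert (D w).par)).lo < (D w).lo ∧
        (D w).hi ≤ (D (vert (D w).par)).hi := by
      intro w hw hwl
      obtain ⟨p, hp, hsame, hpid, h1, h2, h3⟩ := (hD w).parent hw.1 (hidl w hw hwl)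
      obtain ⟨v, hv, rfl⟩ := mem_recordView.1 hp
      have hpid' : ids v = (D w).par := hpid
      rw [← hpid', hvert]
      exact ⟨⟨hsame.1, hsame.2.trans hw.2⟩, hv, rfl, h1, h2, h3⟩
    have hlead := (hD l).leader hld (hl.trans hll.symm)
    have hnum : Numbering G P l (fun w => vert (D w).par) (fun w => (D w).lev)
        (fun w => (D w).lo) (fun w => (D w).hi) := by
      constructor
      · exact hlP
      · exact hlead.1
      · exact hlead.2.1
      · exact fun w hw => (hD w).lo_le hw.1
      · exact fun w hw hwl => (hpar w hw hwl).1
      · exact fun w hw hwl => (hpar w hw hwl).2.1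
      · exact fun w hw hwl => (hpar w hw hwl).2.2.2.1
      · exact fun w hw hwl => (hpar w hw hwl).2.2.2.2.1
      · exact fun w hw hwl => (hpar w hw hwl).2.2.2.2.2
      · intro w hw x hx1 hx2
        obtain ⟨p, ⟨⟨hp, hsame, hpl, hppar⟩, hpx⟩, huniq⟩ := (hD w).children hw.1 x hx1 hx2
        obtain ⟨v, hv, rfl⟩ := mem_recordView.1 hp
        have hppar' : (D v).par = ids w := hppar
        refine ⟨v, ⟨⟨⟨hsame.1, hsame.2.trans hw.2⟩, ?_, ?_⟩, hpx⟩, ?_⟩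
        · rintro rfl
          exact hpl (hl.trans hw.2.symm)
        · simp only [hppar', hvert]
        · rintro v' ⟨⟨hv', hvl', hvw'⟩, hvx'⟩
          have h := hpar v' hv' hvl'
          rw [hvw'] at h
          have := huniq (ids v', D v') ⟨⟨recordView_mem ids D h.2.1.symm,
            ⟨hv'.1, hv'.2.trans hw.2.symm⟩, ?_, h.2.2.1.symm⟩, hvx'⟩
          · exact hids (congrArg Prod.fst this)
          · have := hidl v' hv' hvl'
            rw [hv'.2] at this
            rw [hw.2]
            exact this
    let _ : Fintype ↥(insert r P) := Fintype.ofFinite _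
    rw [← isMinor_induce_iff]
    refine hA ↥(insert r P) (G.induce (insert r P)) (hnum.connected_insert hlr)
      (blockIds r (fun x => (D x).lo) _) (hnum.validIds hk hrP)
      (blockCert r (fun x => (D x).cert) (D u).rootCert _) ?_
    rw [accepts_block_iff (ids := ids) A hrP ?_ ?_ (fun x hx => (hconst x hx).2.2) hlP]
    · refine ⟨?_, fun x hx => (hD x).simulate hx.1⟩
      -- The adjacent leader `l` is what triggers the simulation at `r`.
      have := (hD r).simulate_root _ (recordView_mem ids D hlr.symm) hld
        (by simp only; rw [(hconst l hlP).1, hir])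
      rw [← (hconst l hlP).2.2]
      exact this
    · intro x hx y
      constructor
      · rintro ⟨h1, h2⟩
        exact ⟨h1, h2.trans hx.2⟩
      · rintro ⟨h1, h2⟩
        exact ⟨h1, h2.trans hx.2.symm⟩
    · intro x hx y
      rw [(hconst x hx).1, ← hir]
      exact hids.eq_iff

end Soundness

/-! ### Completeness: records for a minor-free graph. -/

section Completeness

variable {V : Type} [Fintype V]

/-- The numbering and the certificates that are used in the block with leader `L`. -/
theorem exists_block_data {k : ℕ} (hk : 1 ≤ k) {W : Type*} {H : SimpleGraph W} {A : Verifier}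
    {f : ℕ → ℕ} (hf : Monotone f)
    (hA : ∀ (V : Type) [Fintype V] (G : SimpleGraph V), G.Connected → ∀ ids : V → ℕ,
      ValidIds k ids → TwoConnected G ∧ MinorFree H G → ∃ c : V → Certificate,
        (∀ v, (c v).length ≤ f (Fintype.card V)) ∧ Accepts A G ids c)
    {G : SimpleGraph V} (hG : MinorFree H G) {P : Set V} {l r : V} (hrP : r ∉ P) (hl : l ∈ P)
    (htwo : TwoConnected (G.induce (insert r P))) :
    ∃ (par : V → V) (lev lo hi : V → ℕ) (cert : V → Certificate),
      Numbering G P l par lev lo hi ∧ (∀ v, (cert v).length ≤ f (Fintype.card V)) ∧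
      ∀ _ : Fintype ↥(insert r P), Accepts A (G.induce (insert r P))
        (blockIds r lo (insert r P)) (blockCert r cert (cert r) (insert r P)) := by
  classical
  -- The root is not a cut-vertex of its block, so the spanning tree can avoid it.
  have hP : (G.induce P).Connected := by
    have hpre := htwo.2 ⟨r, Or.inl rfl⟩
    have : Nonempty P := ⟨⟨l, hl⟩⟩
    refine ⟨fun x y => ?_⟩
    have hne : ∀ z : P, (⟨z.1, Or.inr z.2⟩ : ↥(insert r P)) ∈
        ({⟨r, Or.inl rfl⟩}ᶜ : Set ↥(insert r P)) := by
      intro z h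
      have e : z.1 = r := congrArg Subtype.val h
      exact hrP (e ▸ z.2)
    have hmem : ∀ z : ↥({⟨r, Or.inl rfl⟩}ᶜ : Set ↥(insert r P)), z.1.1 ∈ P := fun z =>
      z.1.2.resolve_left fun h => z.2 (Subtype.ext h)
    exact reachable_of_adj_reachable (G' := G.induce P) (fun z => ⟨z.1.1, hmem z⟩)
      (fun u v huv => Adj.reachable (by exact huv)) (hpre ⟨_, hne x⟩ ⟨_, hne y⟩)
  obtain ⟨par, lev, lo, hi, hnum⟩ := exists_numbering hP hl
  let _ : Fintype ↥(insert r P) := Fintype.ofFinite _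
  obtain ⟨c, hc1, hc2⟩ := hA ↥(insert r P) (G.induce (insert r P)) htwo.1 _
    (hnum.validIds hk hrP) ⟨htwo, fun h => hG (isMinor_induce_iff.1 h).isMinor⟩
  refine ⟨par, lev, lo, hi, fun v => if h : v ∈ insert r P then c ⟨v, h⟩ else [], hnum, ?_, ?_⟩
  · intro v
    dsimp only
    split_ifs with h
    -- A block has at most as many vertices as the graph, so monotonicity of `f` bounds its
    -- certificates.
    · exact (hc1 _).trans (hf (Fintype.card_subtype_le _))
    · exact Nat.zero_le _
  · intro inst
    have : blockCert r (fun v => if h : v ∈ insert r P then c ⟨v, h⟩ else [])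
        (if h : r ∈ insert r P then c ⟨r, h⟩ else []) (insert r P) = c := by
      funext x
      by_cases hx : x.1 = r
      · simp only [blockCert, hx, if_true]
        rw [dif_pos (Set.mem_insert r P)]
        exact congrArg c (Subtype.ext hx.symm)
      · simp only [blockCert, hx, if_false, x.2, dif_pos]
    rw [this]
    convert hc2

/-- The records come from a decomposition of the whole graph, a numbering of each part, and the
certificates that the given verifier accepts on each piece. -/
theorem exists_localCheck {k : ℕ} (hk : 1 ≤ k) {W : Type*} {H : SimpleGraph W} {A : Verifier}
    {f : ℕ → ℕ} (hf : Monotone f)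
    (hA : ∀ (V : Type) [Fintype V] (G : SimpleGraph V), G.Connected → ∀ ids : V → ℕ,
      ValidIds k ids → TwoConnected G ∧ MinorFree H G → ∃ c : V → Certificate,
        (∀ v, (c v).length ≤ f (Fintype.card V)) ∧ Accepts A G ids c)
    {G : SimpleGraph V} (hconn : G.Connected) (hG : MinorFree H G)
    (hcard : 2 ≤ Fintype.card V) {ids : V → ℕ} (hids : ValidIds k ids) :
    ∃ D : V → VertexRecord,
      (∀ v, (D v).encode.length ≤ (28 * k + 22) * (f (Fintype.card V) +
        Nat.log 2 (Fintype.card V))) ∧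
      ∀ v, LocalCheck A (ids v) (D v) (recordView G ids D v) := by
  classical
  obtain ⟨r⟩ := hconn.nonempty
  have huniv : (G.induce Set.univ).Connected := (induceUnivIso G).connected_iff.2 hconn
  obtain ⟨lead, root, depth, hB⟩ := exists_blockDecomp G Set.univ r (Set.mem_univ r) huniv
  have hd : ∀ u, depth u ≠ 0 ↔ u ≠ r := fun u =>
    ⟨fun h h' => h (h' ▸ hB.depth_root), hB.depth_ne_zero u (Set.mem_univ u)⟩
  -- Indexing by the leader makes all vertices of a part use the same tree and certificates; if `L`
  -- leads no part, the data are dummies.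
  have hdata : ∀ L : V, ∃ (par : V → V) (lev lo hi : V → ℕ) (cert : V → Certificate),
      (∀ v, (cert v).length ≤ f (Fintype.card V)) ∧
      ∀ u, u ≠ r → lead u = L → Numbering G {w | w ≠ r ∧ lead w = L} L par lev lo hi ∧
        ∀ _ : Fintype ↥(insert (root u) {w | w ≠ r ∧ lead w = L}),
          Accepts A (G.induce (insert (root u) {w | w ≠ r ∧ lead w = L}))
            (blockIds (root u) lo (insert (root u) {w | w ≠ r ∧ lead w = L}))
            (blockCert (root u) cert (cert (root u))
              (insert (root u) {w | w ≠ r ∧ lead w = L})) := by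
    intro L
    by_cases hL : ∃ u, u ≠ r ∧ lead u = L
    · obtain ⟨u, hur, rfl⟩ := hL
      have htwo := hB.block u (Set.mem_univ u) hur
      have hset : {w | w ∈ Set.univ ∧ w ≠ r ∧ lead w = lead u} =
          {w | w ≠ r ∧ lead w = lead u} := by
        simp only [Set.mem_univ, true_and]
      rw [hset] at htwo
      have hrP : root u ∉ {w | w ≠ r ∧ lead w = lead u} := fun h => by
        have h1 := (hB.const _ (Set.mem_univ (root u)) u (Set.mem_univ u) h.1 hur h.2).2
        have h2 := hB.depth_lt u (Set.mem_univ u) hur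
        omega
      have hl : lead u ∈ {w | w ≠ r ∧ lead w = lead u} :=
        ⟨hB.lead_ne u (Set.mem_univ u) hur, hB.lead_lead u (Set.mem_univ u) hur⟩
      obtain ⟨par, lev, lo, hi, cert, h1, h2, h3⟩ := exists_block_data hk hf hA hG hrP hl htwo
      refine ⟨par, lev, lo, hi, cert, h2, fun u' hur' hu' => ⟨h1, ?_⟩⟩
      rw [(hB.const u' (Set.mem_univ _) u (Set.mem_univ _) hur' hur hu').1]
      exact h3
    · exact ⟨id, fun _ => 0, fun _ => 0, fun _ => 0, fun _ => [], fun _ => Nat.zero_le _,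
        fun u hur hu => absurd ⟨u, hur, hu⟩ hL⟩
  choose par lev lo hi cert hlen hdata using hdata
  -- In the record of the global root only the depth 0 matters.
  let D : V → VertexRecord := fun w => if w = r then ⟨0, 0, 0, 0, 0, 0, 0, [], []⟩ else
    ⟨depth w, ids (lead w), ids (root w), ids (par (lead w) w), lev (lead w) w, lo (lead w) w,
      hi (lead w) w, cert (lead w) w, cert (lead w) (root w)⟩
  have hDr : D r = ⟨0, 0, 0, 0, 0, 0, 0, [], []⟩ := if_pos rfl
  have hDw : ∀ w, w ≠ r → D w = ⟨depth w, ids (lead w), ids (root w), ids (par (lead w) w),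
      lev (lead w) w, lo (lead w) w, hi (lead w) w, cert (lead w) w,
      cert (lead w) (root w)⟩ := fun w hw => if_neg hw
  have hDd : ∀ w, (D w).depth ≠ 0 ↔ w ≠ r := by
    intro w
    by_cases hw : w = r
    · rw [hw, hDr]
      simp
    · rw [hDw w hw]
      exact hd w
  have hDd' : ∀ w, (D w).depth = depth w := by
    intro w
    by_cases hw : w = r
    · rw [hw, hDr, hB.depth_root]
    · rw [hDw w hw]
  have hinj := hids.1
  have hnum : ∀ w, w ≠ r → Numbering G {x | x ≠ r ∧ lead x = lead w} (lead w) (par (lead w))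
      (lev (lead w)) (lo (lead w)) (hi (lead w)) := fun w hw => (hdata _ w hw rfl).1
  have hsame : ∀ w, w ≠ r → ∀ x, SamePart (D w) (ids x, D x) ↔ x ≠ r ∧ lead x = lead w := by
    intro w hw x
    simp only [SamePart, hDd]
    constructor
    · rintro ⟨h1, h2⟩
      rw [hDw w hw, hDw x h1] at h2
      exact ⟨h1, hinj h2⟩
    · rintro ⟨h1, h2⟩
      refine ⟨h1, ?_⟩
      rw [hDw w hw, hDw x h1, h2]
  have hconst : ∀ w, w ≠ r → ∀ x, x ≠ r → lead x = lead w →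
      root x = root w ∧ depth x = depth w := fun w hw x hx h =>
    hB.const x (Set.mem_univ _) w (Set.mem_univ _) hx hw h
  have hacc : ∀ u, u ≠ r →
      A (1, (D u).rootCert) (partView (D u) (recordView G ids D (root u))) = true ∧
      A ((D u).lo, (D u).cert) (partView (D u) (recordView G ids D u) ∪
        rootView (D u) (recordView G ids D u)) = true := by
    intro u hu
    have hacc := (hdata (lead u) u hu rfl).2
    set P : Set V := {w | w ≠ r ∧ lead w = lead u} with hP
    have huP : u ∈ P := ⟨hu, rfl⟩
    have hrP : root u ∉ P := fun h => by
      have h1 := (hconst u hu _ h.1 h.2).2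
      have h2 := hB.depth_lt u (Set.mem_univ u) hu
      omega
    let inst : Fintype ↥(insert (root u) P) := Fintype.ofFinite _
    have h := hacc inst
    have e1 : blockIds (root u) (lo (lead u)) (insert (root u) P) =
        blockIds (root u) (fun x => (D x).lo) (insert (root u) P) := by
      funext x
      simp only [blockIds]
      split_ifs with hx
      · rfl
      · have hxP : x.1 ∈ P := x.2.resolve_left hx
        rw [hDw x.1 hxP.1, hxP.2]
    have e2 : blockCert (root u) (cert (lead u)) (cert (lead u) (root u)) (insert (root u) P) =
        blockCert (root u) (fun x => (D x).cert) (D u).rootCert (insert (root u) P) := by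
      funext x
      simp only [blockCert]
      split_ifs with hx
      · rw [hDw u hu]
      · have hxP : x.1 ∈ P := x.2.resolve_left hx
        rw [hDw x.1 hxP.1, hxP.2]
    rw [e1, e2, accepts_block_iff (ids := ids) A hrP ?_ ?_ ?_ huP] at h
    · exact ⟨h.1, h.2 u huP⟩
    · intro x hx y
      rw [hsame x hx.1 y, hx.2]
      rfl
    · intro x hx y
      rw [hDw x hx.1]
      simp only [(hconst u hu x hx.1 hx.2).1]
      exact hinj.eq_iff
    · intro x hx
      rw [hDw x hx.1, hDw u hu]
      simp only [(hconst u hu x hx.1 hx.2).1, hx.2]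
  refine ⟨D, ?_, ?_⟩
  · intro v
    have hnk : Fintype.card V ≤ Fintype.card V ^ k := Nat.le_self_pow (by omega) _
    by_cases hv : v = r
    · rw [hv, hDr]
      exact VertexRecord.length_encode_le_log hk hcard (Nat.zero_le _) (Nat.zero_le _)
        (Nat.zero_le _) (Nat.zero_le _) (Nat.zero_le _) (Nat.zero_le _) (Nat.zero_le _)
        (Nat.zero_le _) (Nat.zero_le _)
    · rw [hDw v hv]
      have hid : ∀ x, ids x ≤ Fintype.card V ^ k + 1 := fun x =>
        (hids.2 x).2.trans (Nat.le_succ _)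
      have hn := hnum v hv
      have hmem : v ∈ {x | x ≠ r ∧ lead x = lead v} := ⟨hv, rfl⟩
      have hPn : ({x | x ≠ r ∧ lead x = lead v} : Set V).ncard ≤ Fintype.card V := by
        rw [← Nat.card_eq_fintype_card, ← Set.ncard_univ]
        exact Set.ncard_le_ncard (Set.subset_univ _) (Set.toFinite _)
      have a1 := hn.lo_le_card (Set.toFinite _) hmem
      have a2 := (hn.hi_le v hmem).trans (hn.hi_root_le (Set.toFinite _))
      have a3 := hn.lev_le v hmem
      have a4 := hB.depth_le v (Set.mem_univ v)
      rw [Set.ncard_univ, Nat.card_eq_fintype_card] at a4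
      refine VertexRecord.length_encode_le_log hk hcard ?_ (hid _) (hid _) (hid _) ?_ ?_ ?_
        (hlen _ _) (hlen _ _)
      · simp only; omega
      · simp only; omega
      · simp only; omega
      · simp only; omega
  · intro v
    constructor
    · intro hv p hp
      obtain ⟨w, hvw, rfl⟩ := mem_recordView.1 hp
      have hvr : v = r := by
        by_contra h
        exact (hDd v).2 h hv
      have hwr : w ≠ r := fun h => hvw.ne (hvr.trans h.symm)
      refine ⟨(hDd w).2 hwr, ?_⟩
      rcases hB.edge v (Set.mem_univ v) w (Set.mem_univ w) hvw with h | h | h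
      · simp only [hDw w hwr, h.2]
      · exact absurd hvr h.1
      · exact absurd hvr h.1
    · intro hv p hp
      obtain ⟨w, hvw, rfl⟩ := mem_recordView.1 hp
      have hvr := (hDd v).1 hv
      rcases hB.edge v (Set.mem_univ v) w (Set.mem_univ w) hvw with h | h | h
      · exact Or.inl ⟨(hDd w).2 h.1, by simp only [hDw w h.1, h.2]⟩
      · exact Or.inr (Or.inl (by simp only [hDw v hvr, h.2]))
      · exact Or.inr (Or.inr ((hsame v hvr w).2 ⟨h.2.1, h.2.2.symm⟩))
    · intro hv p hp hsp
      obtain ⟨w, hvw, rfl⟩ := mem_recordView.1 hp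
      have hvr := (hDd v).1 hv
      obtain ⟨hwr, hl⟩ := (hsame v hvr w).1 hsp
      obtain ⟨h1, h2⟩ := hconst v hvr w hwr hl
      simp only [hDw v hvr, hDw w hwr, h1, h2, hl, and_self]
    · intro hv p hp hpr
      obtain ⟨w, hvw, rfl⟩ := mem_recordView.1 hp
      have hvr := (hDd v).1 hv
      simp only [hDw v hvr] at hpr
      have hw : w = root v := hinj hpr
      simp only [hDd']
      rw [hw]
      exact hB.depth_lt v (Set.mem_univ v) hvr
    · intro hv hl
      have hvr := (hDd v).1 hv
      have hn := hnum v hvr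
      have hadj := hB.adj v (Set.mem_univ v) hvr
      rw [hDw v hvr] at hl ⊢
      have hl' : v = lead v := hinj hl
      refine ⟨?_, ?_, (ids (root v), D (root v)), recordView_mem ids D ?_, rfl⟩
      · have := hn.lev_root
        rwa [← hl'] at this ⊢
      · have := hn.lo_root
        rwa [← hl'] at this ⊢
      · rw [← hl'] at hadj
        exact hadj.symm
    · intro hv hl
      have hvr := (hDd v).1 hv
      have hn := hnum v hvr
      have hvP : v ∈ {x | x ≠ r ∧ lead x = lead v} := ⟨hvr, rfl⟩
      have hvl : v ≠ lead v := by
        intro h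
        rw [hDw v hvr] at hl
        exact hl (congrArg ids h)
      have hpP := hn.par_mem v hvP hvl
      refine ⟨(ids (par (lead v) v), D (par (lead v) v)),
        recordView_mem ids D (hn.par_adj v hvP hvl), (hsame v hvr _).2 hpP, ?_, ?_, ?_, ?_⟩
      · simp only [hDw v hvr]
      · simp only [hDw v hvr, hDw _ hpP.1, hpP.2]
        exact hn.lev_par v hvP hvl
      · simp only [hDw v hvr, hDw _ hpP.1, hpP.2]
        exact hn.lo_par v hvP hvl
      · simp only [hDw v hvr, hDw _ hpP.1, hpP.2]
        exact hn.hi_par v hvP hvl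
    · intro hv
      have hvr := (hDd v).1 hv
      rw [hDw v hvr]
      exact (hnum v hvr).lo_le v ⟨hvr, rfl⟩
    · intro hv x hx1 hx2
      have hvr := (hDd v).1 hv
      have hn := hnum v hvr
      rw [hDw v hvr] at hx1 hx2
      obtain ⟨w, ⟨⟨hw, hwl, hwv⟩, hwx⟩, huniq⟩ := hn.children v ⟨hvr, rfl⟩ x hx1 hx2
      refine ⟨(ids w, D w), ⟨⟨recordView_mem ids D ?_, (hsame v hvr w).2 hw, ?_, ?_⟩, ?_⟩, ?_⟩
      · have := hn.par_adj w hw hwl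
        rw [hwv] at this
        exact this.symm
      · rw [hDw v hvr]
        exact fun h => hwl (hinj h)
      · simp only [hDw w hw.1, hw.2, hwv]
      · simp only [hDw w hw.1, hw.2]
        exact hwx
      · rintro p ⟨⟨hp, hsp, hpl, hpar⟩, hpx⟩
        obtain ⟨u, hvu, rfl⟩ := mem_recordView.1 hp
        have hu := (hsame v hvr u).1 hsp
        simp only [hDw u hu.1, hu.2] at hpar hpx
        have : u = w := huniq u ⟨⟨hu, fun h => hpl (by simp only [hDw v hvr, h]),
          hinj hpar⟩, hpx⟩
        rw [this]
    · intro hv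
      exact (hacc v ((hDd v).1 hv)).2
    · intro p hp hpd hpr
      obtain ⟨w, hvw, rfl⟩ := mem_recordView.1 hp
      have hwr := (hDd w).1 hpd
      simp only [hDw w hwr] at hpr
      have := (hacc w hwr).1
      rw [hinj hpr] at this
      exact this

end Completeness

end LocalCert

/-! ### The verifier for connected graphs. -/

theorem mainTheorem5 (k : ℕ) (hk : 1 ≤ k) {W : Type*} [Finite W] (H : SimpleGraph W)
    (hH : LocalCert.TwoConnected H) :
    ∃ C : ℕ, ∀ f : ℕ → ℕ, Monotone f →
      LocalCert.CertifiableWith k f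
        (fun {_} G => LocalCert.TwoConnected G ∧ LocalCert.MinorFree H G) →
      LocalCert.CertifiableWith k (fun n => C * (f n + Nat.log 2 n))
        (fun {_} G => LocalCert.MinorFree H G) := by
  classical
  refine ⟨28 * k + 22, fun f hf => ?_⟩
  rintro ⟨A, hA⟩
  let dec := LocalCert.VertexRecord.decode
  -- A one-vertex `H` is a minor of every connected graph, so then everything is rejected. The case
  -- `N = ∅` is the one-vertex graph, where the bound may be 0 bits and no record can be stored.
  refine ⟨fun p N => decide (Nontrivial W ∧ (N = ∅ ∨ LocalCert.LocalCheck A p.1 (dec p.2)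
    (N.image fun q => (q.1, dec q.2)))), ?_⟩
  intro V _ G hG ids hids
  have hview : ∀ c v, LocalCert.neighborView G ids c v = ∅ → Subsingleton V := by
    intro c v hv
    by_contra hV
    rw [not_subsingleton_iff_nontrivial] at hV
    obtain ⟨u, hu⟩ := hG.preconnected.exists_adj_of_nontrivial v
    have : (ids u, c u) ∈ LocalCert.neighborView G ids c v := by
      simp only [LocalCert.neighborView, Finset.mem_image, Finset.mem_filter]
      exact ⟨u, ⟨Finset.mem_univ _, hu⟩, rfl⟩
    rw [hv] at this
    exact absurd this (Finset.notMem_empty _)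
  refine ⟨fun hfree => ?_, fun hnot c hc => hnot ?_⟩
  · have hW : Nontrivial W := by
      by_contra hW
      rw [not_nontrivial_iff_subsingleton] at hW
      obtain ⟨v⟩ := hG.nonempty
      refine hfree ⟨fun _ => Set.univ, fun _ => ?_, fun a b hab => ?_, fun a b hab => ?_⟩
      · exact (SimpleGraph.induceUnivIso G).connected_iff.2 hG
      · exact absurd (Subsingleton.elim a b) hab
      · exact absurd (Subsingleton.elim a b) hab.ne
    by_cases hcard : 2 ≤ Fintype.card V
    · obtain ⟨D, hD1, hD2⟩ := LocalCert.exists_localCheck hk hf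
        (fun V _ G h1 ids h2 => (hA V G h1 ids h2).1) hG hfree hcard hids
      refine ⟨fun v => (D v).encode, hD1, fun v => ?_⟩
      rw [decide_eq_true_iff]
      refine ⟨hW, Or.inr ?_⟩
      rw [LocalCert.recordView_comp]
      simp only [dec, LocalCert.VertexRecord.decode_encode]
      exact hD2 v
    · have hsub : Subsingleton V := Fintype.card_le_one_iff_subsingleton.1 (by omega)
      refine ⟨fun _ => [], fun _ => Nat.zero_le _, fun v => ?_⟩
      rw [decide_eq_true_iff]
      refine ⟨hW, Or.inl ?_⟩
      simp only [LocalCert.neighborView, Finset.image_eq_empty, Finset.filter_eq_empty_iff]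
      exact fun u _ hu => hu.ne (Subsingleton.elim v u)
  · have hc' := fun v => of_decide_eq_true (hc v)
    obtain ⟨v₀⟩ := hG.nonempty
    have hW : Nontrivial W := (hc' v₀).1
    by_cases hV : Subsingleton V
    · rintro ⟨B, hB, hdisj, _⟩
      obtain ⟨a, b, hab⟩ := hW
      obtain ⟨x⟩ := (hB a).nonempty
      obtain ⟨y⟩ := (hB b).nonempty
      exact Set.disjoint_left.1 (hdisj a b hab) x.2 (Subsingleton.elim y.1 x.1 ▸ y.2)
    -- Soundness holds for arbitrary records, so strings that encode no record do no harm.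
    · refine LocalCert.minorFree_of_localCheck (A := A) (D := fun v => dec (c v)) hk hH ?_ hids.1 ?_
      · intro V _ G h1 ids h2 c h3
        by_contra h4
        exact (hA V G h1 ids h2).2 (fun h => h4 h.2) c h3
      · intro v
        have := (hc' v).2.resolve_left fun h => hV (hview c v h)
        rwa [LocalCert.recordView_comp] at this
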